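/- Let $\mathbf{C}$ be a small filtered category with an orthogonality relation $\perp$, i.e. a set of cospans $(f_1:U_1\to V\leftarrow U_2:f_2)$, written $f_1\perp f_2$, closed under transposition and under pre- and postcomposition. Assume: (a) for every $U\in\mathbf{C}$ there is an orthogonal cospan $(U'\to V)\perp(U\to V)$; (b) for every $(U_1\to\widetilde U)\perp(U_2\to\widetilde U)$ there are a morphism $\widetilde U\to W$ and orthogonal cospans $(V_1\to W)\perp(V_2\to W)$ and $(U_i'\to V_i)\perp(U_i\to V_i)$, $i=1,2$, such that $(U_i'\to V_i\to W)\perp(\widetilde U\to W)$ for $i=1,2$. Let $\mathfrak{A}$ be an AQFT on $\mathbf{C}^\perp$, i.e. a functor from $\mathbf{C}$ to unital $C^*$-algebras such that $\mathfrak{A}(f_1)$ and $\mathfrak{A}(f_2)$ have commuting images whenever $f_1\perp f_2$. Let $\mathfrak{A}_\star=\operatorname{colim}\mathfrak{A}$, let $H_0$ be a Hilbert space and $\pi_0:\mathfrak{A}_\star\to B(H_0)$ a unital $*$-homomorphism. For a representation $\pi:\mathfrak{A}_\star\to B(H)$ write $\pi_U$ for its restriction along $\mathfrak{A}(U)\to\mathfrak{A}_\star$.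 Assume that every $\pi_{0U}$ is faithful and that Haag duality holds: for all $U$, $\;\mathfrak{M}(U):=\pi_{0U}(\mathfrak{A}(U))''=\bigcap_{(U'\to V)\perp(U\to V)}\pi_{0U'}(\mathfrak{A}(U'))'$. Let $\mathfrak{M}_\star\subseteq B(H_0)$ be the norm closure of $\bigcup_U\mathfrak{M}(U)$, which is the colimit of $\mathfrak{M}$. For $U\in\mathbf{C}$, let $\mathbf{SSS}(U)$ be the $C^*$-category whose objects are the representations $\pi:\mathfrak{A}_\star\to B(H_0)$ such that $\pi_{U'}=\pi_{0U'}$ for all $(U'\to V)\perp(U\to V)$, and such that for each $W\in\mathbf{C}$ there is a unitary $v$ with $v\,\pi_{W'}(-)=\pi_{0W'}(-)\,v$ for all $(W'\to V)\perp(W\to V)$; its morphisms are the bounded intertwiners. Let $\mathbf{End}(U)$ be the $C^*$-category whose objects are the $*$-endomorphisms $\rho$ of $\mathfrak{M}_\star$ such that $\rho$ restricts to the inclusion on $\mathfrak{M}(U')$ for all $(U'\to V)\perp(U\to V)$, and such that for each $W\in\mathbf{C}$ there is a unitary $v\in B(H_0)$ with $v\,\rho(b)=b\,v$ for all $(W'\to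 V)\perp(W\to V)$ and $b\in\mathfrak{M}(W')$; its morphisms $\rho\to\rho'$ are the $T\in\mathfrak{M}(U)$ with $T\rho(-)=\rho'(-)T$. Then: 1. For each $U$, the assignment $\rho\mapsto\rho\circ\pi_0$, $T\mapsto T$ is an isomorphism of $C^*$-categories $\mathbf{End}(U)\cong\mathbf{SSS}(U)$; identify the two. 2. Each $\mathbf{SSS}(U)$ is a strict monoidal $C^*$-category with $\rho\diamond\dot\rho=\rho\circ\dot\rho$, with $T\diamond\dot T=T\,\rho(\dot T)$ for $T:\rho\to\rho'$ and $\dot T:\dot\rho\to\dot\rho'$, and with unit $\mathrm{id}$. 3. For every tuple $\underline f=(f_i:U_i\to V)_{i=1}^n$, $n\ge0$, with $f_i\perp f_j$ for all $i\ne j$, let $$\mathbf{SSS}(\underline f):\ \bigotimes_{i=1}^n\mathbf{SSS}(U_i)\to\mathbf{SSS}(V)$$ be the $*$-functor on the maximal tensor product (equivalently, the multilinear $*$-functor on $\prod_i\mathbf{SSS}(U_i)$) given by including each $\mathbf{SSS}(U_i)$ into $\mathbf{SSS}(V)$ and taking the $n$-fold product $\diamond^n$ (the monoidal unit for $n=0$).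 These $*$-functors are strictly monoidal, and they make $\mathbf{SSS}$ a prefactorization algebra over $\mathbf{C}^\perp$ with values in strict monoidal $C^*$-categories: they preserve operadic identities and compositions and are equivariant under permutations. 4. This prefactorization algebra is locally constant: for every morphism $f:U\to\widetilde U$ in $\mathbf{C}$, $\mathbf{SSS}(f):\mathbf{SSS}(U)\to\mathbf{SSS}(\widetilde U)$ is a unitary equivalence of strict monoidal $C^*$-categories, i.e. a strict monoidal $*$-functor with a quasi-inverse $*$-functor such that both natural isomorphisms are unitary. -/

import Mathlib

open CategoryTheory

universe u v w

noncomputable section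

/-! ## Strict monoidal C*-categories and their multilinear functors -/

/-- A (unital) C*-category over `ℂ`. As `f ≫ g` is composition in diagrammatic order,
`f ≫ dagger f` is the endomorphism `f* ∘ f` of the source of `f`. -/
class CStarCategory (A : Type u) [Category.{v} A] where
  normedAddCommGroup : ∀ X Y : A, NormedAddCommGroup (X ⟶ Y)
  normedSpace : ∀ X Y : A, NormedSpace ℂ (X ⟶ Y)
  completeSpace : ∀ X Y : A, CompleteSpace (X ⟶ Y)
  add_comp : ∀ {X Y Z : A} (f f' : X ⟶ Y) (g : Y ⟶ Z), (f + f') ≫ g = f ≫ g + f' ≫ g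
  comp_add : ∀ {X Y Z : A} (f : X ⟶ Y) (g g' : Y ⟶ Z), f ≫ (g + g') = f ≫ g + f ≫ g'
  smul_comp : ∀ {X Y Z : A} (c : ℂ) (f : X ⟶ Y) (g : Y ⟶ Z), (c • f) ≫ g = c • (f ≫ g)
  comp_smul : ∀ {X Y Z : A} (c : ℂ) (f : X ⟶ Y) (g : Y ⟶ Z), f ≫ (c • g) = c • (f ≫ g)
  norm_comp_le : ∀ {X Y Z : A} (f : X ⟶ Y) (g : Y ⟶ Z), ‖f ≫ g‖ ≤ ‖f‖ * ‖g‖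
  dagger : ∀ {X Y : A}, (X ⟶ Y) → (Y ⟶ X)
  dagger_dagger : ∀ {X Y : A} (f : X ⟶ Y), dagger (dagger f) = f
  dagger_add : ∀ {X Y : A} (f g : X ⟶ Y), dagger (f + g) = dagger f + dagger g
  dagger_smul : ∀ {X Y : A} (c : ℂ) (f : X ⟶ Y), dagger (c • f) = star c • dagger f
  dagger_comp : ∀ {X Y Z : A} (f : X ⟶ Y) (g : Y ⟶ Z), dagger (f ≫ g) = dagger g ≫ dagger f
  norm_comp_dagger : ∀ {X Y : A} (f : X ⟶ Y), ‖f ≫ dagger f‖ = ‖f‖ ^ 2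
  /-- `f* ∘ f` is a positive element of the C*-algebra of endomorphisms of the source. -/
  comp_dagger_nonneg : ∀ {X Y : A} (f : X ⟶ Y), ∃ g : X ⟶ X, f ≫ dagger f = g ≫ dagger g

attribute [reducible] CStarCategory.normedAddCommGroup CStarCategory.normedSpace

attribute [instance] CStarCategory.normedAddCommGroup CStarCategory.normedSpace
  CStarCategory.completeSpace

namespace CStarCategory

variable {A : Type*} [Category A] [CStarCategory A] {B : Type*} [Category B] [CStarCategory B]

/-- A morphism of a C*-category is unitary if its adjoint is a two-sided inverse. -/
def IsUnitary {X Y : A} (f : X ⟶ Y) : Prop :=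
  f ≫ dagger f = 𝟙 X ∧ dagger f ≫ f = 𝟙 Y

/-- A functor between C*-categories is a *-functor if it is `ℂ`-linear on morphisms and preserves
adjoints. -/
structure IsStarFunctor (F : A ⥤ B) : Prop where
  map_add : ∀ {X Y : A} (f g : X ⟶ Y), F.map (f + g) = F.map f + F.map g
  map_smul : ∀ {X Y : A} (c : ℂ) (f : X ⟶ Y), F.map (c • f) = c • F.map f
  map_dagger : ∀ {X Y : A} (f : X ⟶ Y), F.map (dagger f) = dagger (F.map f)

/-- A *-functor is a unitary equivalence if it has a quasi-inverse *-functor, the two natural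
isomorphisms having unitary components. -/
structure IsUnitaryEquivalence (F : A ⥤ B) : Prop where
  isStarFunctor : IsStarFunctor F
  exists_inverse : ∃ G : B ⥤ A, IsStarFunctor G ∧
    (∃ η : 𝟭 A ≅ F ⋙ G, ∀ X, IsUnitary (η.hom.app X)) ∧
    (∃ ε : G ⋙ F ≅ 𝟭 B, ∀ Y, IsUnitary (ε.hom.app Y))

/-- A functor out of a finite product of C*-categories is a multilinear *-functor if it is
`ℂ`-multilinear on morphisms and preserves adjoints. -/
structure IsMultiStarFunctor {n : ℕ} {X : Fin n → Type*} [∀ i, Category (X i)]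
    [∀ i, CStarCategory (X i)] (F : (∀ i, X i) ⥤ B) : Prop where
  multilinear : ∀ x y : ∀ i, X i,
    ∃ L : MultilinearMap ℂ (fun i => x i ⟶ y i) (F.obj x ⟶ F.obj y),
      ∀ f : (∀ i, x i ⟶ y i), L f = F.map (X := x) (Y := y) f
  map_dagger : ∀ (x y : ∀ i, X i) (f : ∀ i, x i ⟶ y i),
    F.map (X := y) (Y := x) (fun i => dagger (f i)) = dagger (F.map (X := x) (Y := y) f)

end CStarCategory

open CStarCategory

/-- A strict monoidal structure on a C*-category: a bilinear *-functor `tensor` and an object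
`unit` such that associativity and unitality hold as equalities of functors. -/
class StrictMonoidalCStar (A : Type u) [Category.{v} A] [CStarCategory A] where
  tensor : A × A ⥤ A
  unit : A
  add_tensor : ∀ {x x' y y' : A} (f g : x ⟶ x') (h : y ⟶ y'),
    tensor.map (X := (x, y)) (Y := (x', y')) (f + g, h) =
      tensor.map (X := (x, y)) (Y := (x', y')) (f, h) +
        tensor.map (X := (x, y)) (Y := (x', y')) (g, h)
  tensor_add : ∀ {x x' y y' : A} (f : x ⟶ x') (g h : y ⟶ y'),
    tensor.map (X := (x, y)) (Y := (x', y')) (f, g + h) =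
      tensor.map (X := (x, y)) (Y := (x', y')) (f, g) +
        tensor.map (X := (x, y)) (Y := (x', y')) (f, h)
  smul_tensor : ∀ {x x' y y' : A} (c : ℂ) (f : x ⟶ x') (h : y ⟶ y'),
    tensor.map (X := (x, y)) (Y := (x', y')) (c • f, h) =
      c • tensor.map (X := (x, y)) (Y := (x', y')) (f, h)
  tensor_smul : ∀ {x x' y y' : A} (c : ℂ) (f : x ⟶ x') (h : y ⟶ y'),
    tensor.map (X := (x, y)) (Y := (x', y')) (f, c • h) =
      c • tensor.map (X := (x, y)) (Y := (x', y')) (f, h)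
  dagger_tensor : ∀ {x x' y y' : A} (f : x ⟶ x') (h : y ⟶ y'),
    tensor.map (X := (x', y')) (Y := (x, y)) (dagger f, dagger h) =
      dagger (tensor.map (X := (x, y)) (Y := (x', y')) (f, h))
  assoc : tensor.prod (𝟭 A) ⋙ tensor =
    prod.associator A A A ⋙ (𝟭 A).prod tensor ⋙ tensor
  unit_tensor : Prod.sectR unit A ⋙ tensor = 𝟭 A
  tensor_unit : Prod.sectL A unit ⋙ tensor = 𝟭 A

namespace StrictMonoidalCStar

/-- The functor `(x₁, …, xₙ) ↦ x₁ ⊗ ⋯ ⊗ xₙ`; it is the monoidal unit for `n = 0`. -/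
def tensorPow (A : Type u) [Category.{v} A] [CStarCategory A] [StrictMonoidalCStar A] :
    (n : ℕ) → (Fin n → A) ⥤ A
  | 0 => (Functor.const _).obj unit
  | n + 1 => (Pi.eval (fun _ : Fin (n + 1) => A) 0).prod'
      (Pi.comap (fun _ : Fin (n + 1) => A) Fin.succ ⋙ tensorPow A n) ⋙ tensor

/-- The componentwise tensor product on a product of strict monoidal C*-categories. -/
def piTensor {n : ℕ} (X : Fin n → Type u) [∀ i, Category.{v} (X i)] [∀ i, CStarCategory (X i)]
    [∀ i, StrictMonoidalCStar (X i)] : (∀ i, X i) × (∀ i, X i) ⥤ ∀ i, X i :=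
  Functor.pi' fun i => (Pi.eval X i).prod (Pi.eval X i) ⋙ tensor

end StrictMonoidalCStar

open StrictMonoidalCStar

/-- A bundled strict monoidal C*-category. -/
structure StrictMonoidalCStarCat where
  carrier : Type u
  [category : Category.{v} carrier]
  [cstar : CStarCategory carrier]
  [monoidal : StrictMonoidalCStar carrier]

namespace StrictMonoidalCStarCat

instance : CoeSort StrictMonoidalCStarCat.{u, v} (Type u) := ⟨carrier⟩

attribute [instance] category cstar monoidal

end StrictMonoidalCStarCat

/-- The `n`-ary morphisms `X₁ ⊗ ⋯ ⊗ Xₙ → Y` of strict monoidal C*-categories. By the universal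
property of the maximal tensor product of C*-categories, *-functors out of `X₁ ⊗ ⋯ ⊗ Xₙ` are the
same as multilinear *-functors out of the product `X₁ × ⋯ × Xₙ`, and the monoidal structure of
`X₁ ⊗ ⋯ ⊗ Xₙ` is componentwise. For `n = 0` this is a morphism out of the tensor unit `Bℂ`. -/
structure StrictMonoidalMultiFunctor {n : ℕ} (X : Fin n → StrictMonoidalCStarCat.{u, v})
    (Y : StrictMonoidalCStarCat.{u, v}) where
  functor : (∀ i, X i) ⥤ Y
  isMultiStarFunctor : IsMultiStarFunctor functor
  map_unit : functor.obj (fun _ => unit) = unit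
  map_tensor : piTensor (fun i => X i) ⋙ functor = functor.prod functor ⋙ tensor

/-- A unitary equivalence of strict monoidal C*-categories: a strict monoidal *-functor whose
underlying *-functor is a unitary equivalence of C*-categories. -/
structure IsUnitaryMonoidalEquivalence {X Y : StrictMonoidalCStarCat.{u, v}} (F : X ⥤ Y) :
    Prop where
  map_unit : F.obj unit = unit
  map_tensor : tensor ⋙ F = F.prod F ⋙ tensor
  isUnitaryEquivalence : IsUnitaryEquivalence F

/-! ## Orthogonal categories and prefactorization algebras -/

/-- An orthogonality relation on a category: a set of cospans which is closed under transposition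
and under pre- and postcomposition. -/
structure Orthogonality (C : Type u) [Category.{v} C] where
  perp : ∀ {U₁ U₂ V : C}, (U₁ ⟶ V) → (U₂ ⟶ V) → Prop
  symm : ∀ {U₁ U₂ V : C} {f₁ : U₁ ⟶ V} {f₂ : U₂ ⟶ V}, perp f₁ f₂ → perp f₂ f₁
  precomp : ∀ {U₁ U₂ V W₁ W₂ : C} {f₁ : U₁ ⟶ V} {f₂ : U₂ ⟶ V} (g₁ : W₁ ⟶ U₁) (g₂ : W₂ ⟶ U₂),
    perp f₁ f₂ → perp (g₁ ≫ f₁) (g₂ ≫ f₂)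
  postcomp : ∀ {U₁ U₂ V W : C} {f₁ : U₁ ⟶ V} {f₂ : U₂ ⟶ V} (h : V ⟶ W),
    perp f₁ f₂ → perp (f₁ ≫ h) (f₂ ≫ h)

variable {C : Type u} [Category.{v} C]

/-- The operations `(U₁, …, Uₙ) → V` of the prefactorization operad. -/
structure PrefactOp (O : Orthogonality C) {n : ℕ} (U : Fin n → C) (V : C) where
  hom : ∀ i, U i ⟶ V
  perp : ∀ i j, i ≠ j → O.perp (hom i) (hom j)

namespace PrefactOp

variable {O : Orthogonality C}

/-- The `1`-ary operation given by a morphism. -/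
def single (O : Orthogonality C) {U V : C} (f : U ⟶ V) : PrefactOp O (fun _ : Fin 1 => U) V where
  hom _ := f
  perp _ _ h := absurd (Subsingleton.elim _ _) h

/-- The action of a permutation on an operation. -/
def permute {n : ℕ} {U : Fin n → C} {V : C} (f : PrefactOp O U V) (σ : Equiv.Perm (Fin n)) :
    PrefactOp O (fun i => U (σ i)) V where
  hom i := f.hom (σ i)
  perp _ _ h := f.perp _ _ (fun h' => h (σ.injective h'))

/-- The concatenation of the tuples `W 0, W 1, …`. -/
def concat {T : Type*} {m : ℕ} {k : Fin m → ℕ} (W : ∀ i, Fin (k i) → T) :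
    Fin (∑ i, k i) → T :=
  fun j => W (finSigmaFinEquiv.symm j).1 (finSigmaFinEquiv.symm j).2

theorem perp_comp {m : ℕ} {k : Fin m → ℕ} {W : ∀ i, Fin (k i) → C} {U : Fin m → C} {V : C}
    (f : PrefactOp O U V) (g : ∀ i, PrefactOp O (W i) (U i)) (a b : (i : Fin m) × Fin (k i))
    (h : a ≠ b) :
    O.perp ((g a.1).hom a.2 ≫ f.hom a.1) ((g b.1).hom b.2 ≫ f.hom b.1) := by
  obtain ⟨a₁, a₂⟩ := a
  obtain ⟨b₁, b₂⟩ := b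
  by_cases e : a₁ = b₁
  · subst e
    exact O.postcomp _ ((g a₁).perp _ _ (fun e => h (congrArg (Sigma.mk a₁) e)))
  · exact O.precomp _ _ (f.perp _ _ e)

/-- Operadic composition. -/
def comp {m : ℕ} {k : Fin m → ℕ} {W : ∀ i, Fin (k i) → C} {U : Fin m → C} {V : C}
    (f : PrefactOp O U V) (g : ∀ i, PrefactOp O (W i) (U i)) : PrefactOp O (concat W) V where
  hom j := (g (finSigmaFinEquiv.symm j).1).hom (finSigmaFinEquiv.symm j).2 ≫
    f.hom (finSigmaFinEquiv.symm j).1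
  perp _ _ h := perp_comp f g _ _ (fun e => h (finSigmaFinEquiv.symm.injective e))

end PrefactOp

/-- The structure of a prefactorization algebra over an orthogonal category on a family of strict
monoidal C*-categories, i.e. of an algebra over the prefactorization operad. -/
structure PrefactorizationStructure (O : Orthogonality C)
    (X : C → StrictMonoidalCStarCat) where
  /-- The factorization products. -/
  act : ∀ {n : ℕ} {U : Fin n → C} {V : C}, PrefactOp O U V →
    StrictMonoidalMultiFunctor (fun i => X (U i)) (X V)
  act_id : ∀ V : C, (act (PrefactOp.single O (𝟙 V))).functor = Pi.eval _ 0
  act_comp : ∀ {m : ℕ} {k : Fin m → ℕ} {W : ∀ i, Fin (k i) → C} {U : Fin m → C} {V : C}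
    (f : PrefactOp O U V) (g : ∀ i, PrefactOp O (W i) (U i)),
    (Functor.pi' fun j => Pi.eval (fun i => ∀ l, X (W i l)) (finSigmaFinEquiv.symm j).1 ⋙
        Pi.eval (fun l => X (W _ l)) (finSigmaFinEquiv.symm j).2) ⋙ (act (f.comp g)).functor =
      (Functor.pi fun i => (act (g i)).functor) ⋙ (act f).functor
  act_permute : ∀ {n : ℕ} {U : Fin n → C} {V : C} (f : PrefactOp O U V)
    (σ : Equiv.Perm (Fin n)),
    Pi.comap (fun i => X (U i)) σ ⋙ (act (f.permute σ)).functor = (act f).functor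

namespace PrefactorizationStructure

variable {O : Orthogonality C} {X : C → StrictMonoidalCStarCat}

/-- The functor assigned to the `1`-ary operation given by a morphism. -/
def unary (F : PrefactorizationStructure O X) {U V : C} (f : U ⟶ V) : X U ⥤ X V :=
  Functor.pi' (fun _ : Fin 1 => 𝟭 (X U)) ⋙ (F.act (PrefactOp.single O f)).functor

/-- A prefactorization algebra is locally constant if all `1`-ary operations act by unitary
equivalences of strict monoidal C*-categories. -/
def IsLocallyConstant (F : PrefactorizationStructure O X) : Prop :=
  ∀ {U V : C} (f : U ⟶ V), IsUnitaryMonoidalEquivalence (F.unary f)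

end PrefactorizationStructure

/-! ## C*-categories of operators in a C*-algebra -/

/-- A family of closed subspaces of a C*-algebra which is closed under products and adjoints. -/
structure OperatorHoms (B : Type w) [CStarAlgebra B] (S : Type u) where
  hom : S → S → Submodule ℂ B
  isClosed : ∀ x y, IsClosed (hom x y : Set B)
  one_mem : ∀ x, 1 ∈ hom x x
  mul_mem : ∀ {x y z b c}, b ∈ hom x y → c ∈ hom y z → c * b ∈ hom x z
  star_mem : ∀ {x y b}, b ∈ hom x y → star b ∈ hom y x

namespace OperatorHoms

variable {B : Type w} [CStarAlgebra B] {S : Type u}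

/-- The category with composition given by the product of `B`. -/
@[reducible]
def category (K : OperatorHoms B S) : Category.{w} S where
  Hom x y := K.hom x y
  id x := ⟨1, K.one_mem x⟩
  comp f g := ⟨g.1 * f.1, K.mul_mem f.2 g.2⟩
  id_comp _ := Subtype.ext (mul_one _)
  comp_id _ := Subtype.ext (one_mul _)
  assoc _ _ _ := Subtype.ext (mul_assoc _ _ _).symm

/-- The endomorphisms of an object as a subalgebra of `B`. -/
def endAlg (K : OperatorHoms B S) (x : S) : StarSubalgebra ℂ B where
  carrier := K.hom x x
  mul_mem' ha hb := K.mul_mem hb ha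
  one_mem' := K.one_mem x
  add_mem' := (K.hom x x).add_mem
  zero_mem' := (K.hom x x).zero_mem
  algebraMap_mem' r := by
    rw [Algebra.algebraMap_eq_smul_one]
    exact (K.hom x x).smul_mem r (K.one_mem x)
  star_mem' := K.star_mem

theorem exists_sqrt (K : OperatorHoms B S) {x y : S} {b : B} (hb : b ∈ K.hom x y) :
    ∃ c ∈ K.hom x x, star b * b = star c * c := by
  have hm : star b * b ∈ K.endAlg x := K.mul_mem hb (K.star_mem hb)
  have hsa : IsSelfAdjoint (star b * b) := IsSelfAdjoint.star_mul_self b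
  have hcl : IsClosed (K.endAlg x : Set B) := K.isClosed x x
  refine ⟨cfc Real.sqrt (star b * b), ?_, ?_⟩
  · exact cfc_mem (hs := hcl) Real.sqrt hm
  · have h1 : IsSelfAdjoint (cfc Real.sqrt (star b * b)) := cfc_predicate _ _
    rw [h1.star_eq, ← cfc_mul Real.sqrt Real.sqrt (star b * b)]
    conv_lhs => rw [← cfc_id' ℝ (star b * b)]
    refine cfc_congr fun t ht => ?_
    exact (Real.mul_self_sqrt (spectrum_star_mul_self_nonneg t ht)).symm

/-- Norm and adjoints are those of `B`. -/
@[reducible]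
def cstarCategory (K : OperatorHoms B S) : @CStarCategory S K.category :=
  letI := K.category
  { normedAddCommGroup := fun x y => inferInstanceAs (NormedAddCommGroup (K.hom x y))
    normedSpace := fun x y => inferInstanceAs (NormedSpace ℂ (K.hom x y))
    completeSpace := fun x y => (K.isClosed x y).completeSpace_coe
    add_comp := fun f f' g => Subtype.ext (mul_add _ _ _)
    comp_add := fun f g g' => Subtype.ext (add_mul _ _ _)
    smul_comp := fun c f g => Subtype.ext (mul_smul_comm _ _ _)
    comp_smul := fun c f g => Subtype.ext (smul_mul_assoc _ _ _)
    norm_comp_le := fun f g => (norm_mul_le g.1 f.1).trans_eq (mul_comm _ _)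
    dagger := fun f => ⟨star f.1, K.star_mem f.2⟩
    dagger_dagger := fun f => Subtype.ext (star_star _)
    dagger_add := fun f g => Subtype.ext (star_add _ _)
    dagger_smul := fun c f => Subtype.ext (star_smul _ _)
    dagger_comp := fun f g => Subtype.ext (star_mul _ _)
    norm_comp_dagger := fun f => (CStarRing.norm_star_mul_self (x := f.1)).trans (sq _).symm
    comp_dagger_nonneg := fun f => by
      obtain ⟨c, hc, h⟩ := K.exists_sqrt f.2
      exact ⟨⟨c, hc⟩, Subtype.ext h⟩ }

end OperatorHoms

/-! ## Algebraic quantum field theories -/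

/-- A bundled unital C*-algebra. -/
structure CStarAlgCat where
  carrier : Type w
  [cstarAlgebra : CStarAlgebra carrier]

namespace CStarAlgCat

instance : CoeSort CStarAlgCat.{w} (Type w) := ⟨carrier⟩

attribute [instance] cstarAlgebra

/-- The category of unital C*-algebras and unital *-homomorphisms. -/
instance : Category.{w} CStarAlgCat.{w} where
  Hom A B := A →⋆ₐ[ℂ] B
  id A := StarAlgHom.id ℂ A
  comp f g := StarAlgHom.comp g f

/-- The *-homomorphism underlying a morphism. -/
def Hom.toStarAlgHom {A B : CStarAlgCat.{w}} (f : A ⟶ B) : A →⋆ₐ[ℂ] B := f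

end CStarAlgCat

/-- A C*-algebraic AQFT: a functor to C*-algebras which maps orthogonal cospans to cospans of
commuting images. -/
structure AQFT (O : Orthogonality C) extends C ⥤ CStarAlgCat.{w} where
  perp_commute : ∀ {U₁ U₂ V : C} (f₁ : U₁ ⟶ V) (f₂ : U₂ ⟶ V), O.perp f₁ f₂ →
    ∀ (a₁ : obj U₁) (a₂ : obj U₂),
      Commute (CStarAlgCat.Hom.toStarAlgHom (map f₁) a₁)
        (CStarAlgCat.Hom.toStarAlgHom (map f₂) a₂)

/-- The algebra of bounded operators. -/
abbrev BddOp (H : Type w) [NormedAddCommGroup H] [InnerProductSpace ℂ H] : Type w := H →L[ℂ] H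

namespace AQFT

variable {O : Orthogonality C} {𝔄 : AQFT.{u, v, w} O}

/-- The universal C*-algebra of an AQFT, i.e. a colimit of the underlying functor. -/
abbrev UniversalAlgebra (𝔄 : AQFT.{u, v, w} O) := Limits.ColimitCocone 𝔄.toFunctor

variable {Astar : 𝔄.UniversalAlgebra}
  {H : Type*} [NormedAddCommGroup H] [InnerProductSpace ℂ H] [CompleteSpace H]
  {H₀ : Type*} [NormedAddCommGroup H₀] [InnerProductSpace ℂ H₀] [CompleteSpace H₀]

/-- The canonical morphism from a local algebra to the universal algebra. -/
def toUniversal (Astar : 𝔄.UniversalAlgebra) (U : C) : 𝔄.obj U →⋆ₐ[ℂ] Astar.cocone.pt :=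
  CStarAlgCat.Hom.toStarAlgHom (Astar.cocone.ι.app U)

/-- The restriction of a representation to a local algebra. -/
def localRep (π : Astar.cocone.pt →⋆ₐ[ℂ] BddOp H) (U : C) : 𝔄.obj U →⋆ₐ[ℂ] BddOp H :=
  π.comp (toUniversal Astar U)

/-- A representation is a superselection sector relative to `π₀` if, for every `U`, it is unitarily
equivalent to `π₀` on all the local algebras of regions orthogonal to `U`. -/
def IsSuperselectionSector (π₀ : Astar.cocone.pt →⋆ₐ[ℂ] BddOp H₀)
    (π : Astar.cocone.pt →⋆ₐ[ℂ] BddOp H) : Prop :=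
  ∀ U : C, ∃ v : H ≃ₗᵢ[ℂ] H₀, ∀ {U' V : C} (f' : U' ⟶ V) (f : U ⟶ V), O.perp f' f →
    ∀ (a : 𝔄.obj U') (x : H), v (localRep π U' a x) = localRep π₀ U' a (v x)

/-- The superselection sectors relative to `π₀` which are strictly localized in `U`. -/
structure LocalizedSector (π₀ : Astar.cocone.pt →⋆ₐ[ℂ] BddOp H₀) (U : C) where
  rep : Astar.cocone.pt →⋆ₐ[ℂ] BddOp H₀
  isSector : IsSuperselectionSector π₀ rep
  localized : ∀ {U' V : C} (f' : U' ⟶ V) (f : U ⟶ V), O.perp f' f →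
    localRep rep U' = localRep π₀ U'

/-- Bounded operators intertwining two representations. -/
def LocalizedSector.homs (π₀ : Astar.cocone.pt →⋆ₐ[ℂ] BddOp H₀) (U : C) :
    OperatorHoms (BddOp H₀) (LocalizedSector π₀ U) where
  hom π π' :=
    { carrier := {T | ∀ a, T * π.rep a = π'.rep a * T}
      add_mem' := fun h k a => by rw [add_mul, mul_add, h a, k a]
      zero_mem' := fun a => by rw [zero_mul, mul_zero]
      smul_mem' := fun c T h a => by rw [smul_mul_assoc, mul_smul_comm, h a] }
  isClosed π π' := by
    have : {T | ∀ a, T * π.rep a = π'.rep a * T} =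
        ⋂ a, {T : BddOp H₀ | T * π.rep a = π'.rep a * T} := by ext; simp
    change IsClosed {T | ∀ a, T * π.rep a = π'.rep a * T}
    rw [this]
    exact isClosed_iInter fun a =>
      isClosed_eq (continuous_id.mul continuous_const) (continuous_const.mul continuous_id)
  one_mem π a := by rw [one_mul, mul_one]
  mul_mem {π π' π'' S T} hS hT a := by
    have hS' := hS a
    have hT' := hT a
    rw [mul_assoc, hS', ← mul_assoc, hT', mul_assoc]
  star_mem {π π' T} hT a := by
    have h := congrArg star (hT (star a))
    simpa only [star_mul, map_star, star_star] using h.symm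

instance (π₀ : Astar.cocone.pt →⋆ₐ[ℂ] BddOp H₀) (U : C) : Category (LocalizedSector π₀ U) :=
  (LocalizedSector.homs π₀ U).category

instance (π₀ : Astar.cocone.pt →⋆ₐ[ℂ] BddOp H₀) (U : C) : CStarCategory (LocalizedSector π₀ U) :=
  (LocalizedSector.homs π₀ U).cstarCategory

/-- The bicommutant of the image of a local algebra. -/
def bicommutant (π₀ : Astar.cocone.pt →⋆ₐ[ℂ] BddOp H₀) (U : C) : StarSubalgebra ℂ (BddOp H₀) :=
  StarSubalgebra.centralizer ℂ
    (StarSubalgebra.centralizer ℂ (Set.range (localRep π₀ U)) : Set (BddOp H₀))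

/-- Haag duality in the representation `π₀`. -/
def HaagDuality (π₀ : Astar.cocone.pt →⋆ₐ[ℂ] BddOp H₀) : Prop :=
  ∀ U : C, (bicommutant π₀ U : Set (BddOp H₀)) =
    {T | ∀ {U' V : C} (f' : U' ⟶ V) (f : U ⟶ V), O.perp f' f →
      T ∈ Set.centralizer (Set.range (localRep π₀ U'))}

/-- The representation `π₀` is faithful on all local algebras. -/
def IsLocallyFaithful (π₀ : Astar.cocone.pt →⋆ₐ[ℂ] BddOp H₀) : Prop :=
  ∀ U : C, Function.Injective (localRep π₀ U)

/-- The universal C*-algebra of the AQFT of bicommutants. For a filtered category the bicommutants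
form a directed family of C*-subalgebras, so that the colimit is the norm closure of their union. -/
def quasiLocal (π₀ : Astar.cocone.pt →⋆ₐ[ℂ] BddOp H₀) : StarSubalgebra ℂ (BddOp H₀) :=
  (⨆ U, bicommutant π₀ U).topologicalClosure

theorem localRep_mem_bicommutant (π₀ : Astar.cocone.pt →⋆ₐ[ℂ] BddOp H₀) (U : C)
    (a : 𝔄.obj U) : localRep π₀ U a ∈ bicommutant π₀ U := by
  rw [← SetLike.mem_coe, bicommutant, StarSubalgebra.coe_centralizer_centralizer]
  exact Set.subset_centralizer_centralizer (Or.inl ⟨a, rfl⟩)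

theorem bicommutant_le_quasiLocal (π₀ : Astar.cocone.pt →⋆ₐ[ℂ] BddOp H₀) (U : C) :
    bicommutant π₀ U ≤ quasiLocal π₀ :=
  (le_iSup (bicommutant π₀) U).trans (StarSubalgebra.le_topologicalClosure _)

theorem bicommutant_mono (π₀ : Astar.cocone.pt →⋆ₐ[ℂ] BddOp H₀) {U V : C} (f : U ⟶ V) :
    bicommutant π₀ U ≤ bicommutant π₀ V := by
  have h : Set.range (localRep π₀ U) ⊆ Set.range (localRep π₀ V) := by
    rintro _ ⟨a, rfl⟩
    refine ⟨CStarAlgCat.Hom.toStarAlgHom (𝔄.map f) a, ?_⟩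
    have := Astar.cocone.w f
    exact congrArg π₀ (DFunLike.congr_fun (F := 𝔄.obj U →⋆ₐ[ℂ] Astar.cocone.pt) this a)
  exact StarSubalgebra.centralizer_le ℂ _ _ (StarSubalgebra.centralizer_le ℂ _ _ h)

/-- The inclusion of a bicommutant into the universal C*-algebra. -/
def inclQuasiLocal (π₀ : Astar.cocone.pt →⋆ₐ[ℂ] BddOp H₀) (U : C) :
    bicommutant π₀ U →⋆ₐ[ℂ] quasiLocal π₀ :=
  StarSubalgebra.inclusion (bicommutant_le_quasiLocal π₀ U)

/-- The local representation with values in the bicommutant. -/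
def localRepBi (π₀ : Astar.cocone.pt →⋆ₐ[ℂ] BddOp H₀) (U : C) :
    𝔄.obj U →⋆ₐ[ℂ] bicommutant π₀ U :=
  (localRep π₀ U).codRestrict (bicommutant π₀ U) (localRep_mem_bicommutant π₀ U)

/-- The superselection sectors strictly localized in `U`, as localized and transportable
*-endomorphisms of the universal C*-algebra of the AQFT of bicommutants. -/
structure LocalizedEndo (π₀ : Astar.cocone.pt →⋆ₐ[ℂ] BddOp H₀) (U : C) where
  endo : quasiLocal π₀ →⋆ₐ[ℂ] quasiLocal π₀
  transportable : ∀ W : C, ∃ v ∈ unitary (BddOp H₀),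
    ∀ {W' V : C} (f' : W' ⟶ V) (f : W ⟶ V), O.perp f' f → ∀ b : bicommutant π₀ W',
      v * (endo (inclQuasiLocal π₀ W' b) : BddOp H₀) = (b : BddOp H₀) * v
  localized : ∀ {U' V : C} (f' : U' ⟶ V) (f : U ⟶ V), O.perp f' f →
    endo.comp (inclQuasiLocal π₀ U') = inclQuasiLocal π₀ U'

/-- Elements of the bicommutant of `U` intertwining two *-endomorphisms. -/
def LocalizedEndo.homs (π₀ : Astar.cocone.pt →⋆ₐ[ℂ] BddOp H₀) (U : C) :
    OperatorHoms (BddOp H₀) (LocalizedEndo π₀ U) where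
  hom ρ ρ' :=
    { carrier := {T | T ∈ bicommutant π₀ U ∧ ∀ b, T * (ρ.endo b : BddOp H₀) = ρ'.endo b * T}
      add_mem' := fun h k => ⟨add_mem h.1 k.1, fun b => by rw [add_mul, mul_add, h.2 b, k.2 b]⟩
      zero_mem' := ⟨zero_mem _, fun b => by rw [zero_mul, mul_zero]⟩
      smul_mem' := fun c T h => ⟨(bicommutant π₀ U).smul_mem h.1 c,
        fun b => by rw [smul_mul_assoc, mul_smul_comm, h.2 b]⟩ }
  isClosed ρ ρ' := by
    have : {T | T ∈ bicommutant π₀ U ∧ ∀ b, T * (ρ.endo b : BddOp H₀) = ρ'.endo b * T} =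
        (bicommutant π₀ U : Set (BddOp H₀)) ∩
          ⋂ b, {T : BddOp H₀ | T * (ρ.endo b : BddOp H₀) = ρ'.endo b * T} := by
      ext; simp
    change IsClosed {T | T ∈ bicommutant π₀ U ∧ ∀ b, T * (ρ.endo b : BddOp H₀) = ρ'.endo b * T}
    rw [this]
    refine IsClosed.inter ?_ (isClosed_iInter fun b =>
      isClosed_eq (continuous_id.mul continuous_const) (continuous_const.mul continuous_id))
    exact Set.isClosed_centralizer _
  one_mem ρ := ⟨one_mem _, fun b => by rw [one_mul, mul_one]⟩
  mul_mem {ρ ρ' ρ'' S T} hS hT := ⟨mul_mem hT.1 hS.1, fun b => by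
    have hS' := hS.2 b
    have hT' := hT.2 b
    rw [mul_assoc, hS', ← mul_assoc, hT', mul_assoc]⟩
  star_mem {ρ ρ' T} hT := ⟨star_mem hT.1, fun b => by
    have h := congrArg star (hT.2 (star b))
    simpa only [star_mul, map_star, star_star, StarMemClass.coe_star] using h.symm⟩

instance (π₀ : Astar.cocone.pt →⋆ₐ[ℂ] BddOp H₀) (U : C) : Category (LocalizedEndo π₀ U) :=
  (LocalizedEndo.homs π₀ U).category

instance (π₀ : Astar.cocone.pt →⋆ₐ[ℂ] BddOp H₀) (U : C) : CStarCategory (LocalizedEndo π₀ U) :=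
  (LocalizedEndo.homs π₀ U).cstarCategory

namespace LocalizedEndo

variable {π₀ : Astar.cocone.pt →⋆ₐ[ℂ] BddOp H₀}

/-- The operator underlying a morphism. -/
def op {U : C} {ρ ρ' : LocalizedEndo π₀ U} (T : ρ ⟶ ρ') : BddOp H₀ :=
  Subtype.val (p := (· ∈ (homs π₀ U).hom ρ ρ')) T

theorem op_mem {U : C} {ρ ρ' : LocalizedEndo π₀ U} (T : ρ ⟶ ρ') : op T ∈ bicommutant π₀ U :=
  (Subtype.property (p := (· ∈ (homs π₀ U).hom ρ ρ')) T).1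

/-- The element of the universal C*-algebra underlying a morphism. -/
def elt {U : C} {ρ ρ' : LocalizedEndo π₀ U} (T : ρ ⟶ ρ') : quasiLocal π₀ :=
  inclQuasiLocal π₀ U ⟨op T, op_mem T⟩

/-- The inclusion of the sectors strictly localized in `U` into those strictly localized in `V`,
for a morphism `U ⟶ V`. -/
def incl (π₀ : Astar.cocone.pt →⋆ₐ[ℂ] BddOp H₀) {U V : C} (f : U ⟶ V) :
    LocalizedEndo π₀ U ⥤ LocalizedEndo π₀ V where
  obj ρ :=
    { endo := ρ.endo
      transportable := ρ.transportable
      localized := fun f' g h => ρ.localized f' (f ≫ g) (by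
        simpa using O.precomp (𝟙 _) f h) }
  map {ρ ρ'} T := ⟨op T, bicommutant_mono π₀ f (op_mem T),
    (Subtype.property (p := (· ∈ (homs π₀ U).hom ρ ρ')) T).2⟩
  map_id _ := rfl
  map_comp _ _ := rfl

end LocalizedEndo

/-- The operator underlying a morphism. -/
def LocalizedSector.op {π₀ : Astar.cocone.pt →⋆ₐ[ℂ] BddOp H₀} {U : C}
    {π π' : LocalizedSector π₀ U} (T : π ⟶ π') : BddOp H₀ :=
  Subtype.val (p := (· ∈ (homs π₀ U).hom π π')) T

/-- `Φ` identifies the endomorphism `ρ` with the representation `ρ ∘ π₀`, and is an isomorphism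
of C*-categories that is the identity on operators. -/
structure IsComparison {π₀ : Astar.cocone.pt →⋆ₐ[ℂ] BddOp H₀} {U : C}
    (Φ : LocalizedEndo π₀ U ⥤ LocalizedSector π₀ U) : Prop where
  obj_apply : ∀ (ρ : LocalizedEndo π₀ U) (W : C) (a : 𝔄.obj W),
    localRep (Φ.obj ρ).rep W a = ρ.endo (inclQuasiLocal π₀ W (localRepBi π₀ W a))
  map_op : ∀ {ρ ρ' : LocalizedEndo π₀ U} (T : ρ ⟶ ρ'),
    LocalizedSector.op (Φ.map T) = LocalizedEndo.op T
  bijective_obj : Function.Bijective Φ.obj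
  bijective_map : ∀ ρ ρ' : LocalizedEndo π₀ U,
    Function.Bijective (Φ.map : (ρ ⟶ ρ') → (Φ.obj ρ ⟶ Φ.obj ρ'))

/-- The strict monoidal structure is given by composition of endomorphisms, by
`T ⊗ T' = T ∘ ρ(T')` for `T : ρ ⟶ σ`, and by the identity endomorphism. -/
structure IsCompositionProduct {π₀ : Astar.cocone.pt →⋆ₐ[ℂ] BddOp H₀} {U : C}
    (m : StrictMonoidalCStar (LocalizedEndo π₀ U)) : Prop where
  tensor_obj : ∀ ρ ρ' : LocalizedEndo π₀ U,
    (m.tensor.obj (ρ, ρ')).endo = ρ.endo.comp ρ'.endo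
  tensor_map : ∀ {ρ σ ρ' σ' : LocalizedEndo π₀ U} (T : ρ ⟶ σ) (T' : ρ' ⟶ σ'),
    LocalizedEndo.op (m.tensor.map (X := (ρ, ρ')) (Y := (σ, σ')) (T, T')) =
      LocalizedEndo.op T * (ρ.endo (LocalizedEndo.elt T') : BddOp H₀)
  unit_endo : m.unit.endo = StarAlgHom.id ℂ (quasiLocal π₀)

/-- The strict monoidal C*-category of sectors strictly localized in `U`, for a given strict
monoidal structure. -/
@[reducible]
def sectorCat (π₀ : Astar.cocone.pt →⋆ₐ[ℂ] BddOp H₀)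
    (m : ∀ U : C, StrictMonoidalCStar (LocalizedEndo π₀ U)) (U : C) : StrictMonoidalCStarCat :=
  letI := m U
  ⟨LocalizedEndo π₀ U⟩

end AQFT

/-! ## Geometric assumptions -/

/-- Every object has an object orthogonal to it. -/
def Orthogonality.HasComplements (O : Orthogonality C) : Prop :=
  ∀ U : C, ∃ (U' V : C) (f' : U' ⟶ V) (f : U ⟶ V), O.perp f' f

/-- Orthogonal objects can be enlarged to orthogonal objects that contain regions which are
orthogonal to the original ones and to the given common ambient object. -/
def Orthogonality.HasOrthogonalEnlargements (O : Orthogonality C) : Prop :=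
  ∀ {U₁ U₂ U : C} (f₁ : U₁ ⟶ U) (f₂ : U₂ ⟶ U), O.perp f₁ f₂ →
    ∃ (W V₁ V₂ U₁' U₂' : C) (h : U ⟶ W) (k₁ : V₁ ⟶ W) (k₂ : V₂ ⟶ W)
      (g₁ : U₁ ⟶ V₁) (g₁' : U₁' ⟶ V₁) (g₂ : U₂ ⟶ V₂) (g₂' : U₂' ⟶ V₂),
      O.perp k₁ k₂ ∧ O.perp g₁' g₁ ∧ O.perp g₂ g₂' ∧
        O.perp (g₁' ≫ k₁) h ∧ O.perp (g₂' ≫ k₂) h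

end

noncomputable section

namespace AQFT

variable {C : Type u} [Category.{v} C] {O : Orthogonality C} {𝔄 : AQFT.{u, v, w} O}
  {Astar : 𝔄.UniversalAlgebra}
  {H₀ : Type w} [NormedAddCommGroup H₀] [InnerProductSpace ℂ H₀] [CompleteSpace H₀]
  {π₀ : Astar.cocone.pt →⋆ₐ[ℂ] BddOp H₀}

/-! ### The net of bicommutants -/

/-! Two principles carry the proof. First, whatever commutes with π₀(𝔄(U)) commutes with its
bicommutant 𝔐(U) (`commute_of_mem_bicommutant`), so intertwining relations pass from 𝔄(U) to 𝔐(U)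
without any normality argument. Second, Haag duality places in 𝔐(U) every operator commuting with
all local algebras orthogonal to U; in particular it localizes intertwiners and transport unitaries.

Each region W has an orthogonal region W', and a unitary transporting a sector to W' implements that
sector on 𝔄(W). Conjugation by it extends the sector to 𝔐(W), independently of choices, and
filteredness glues these extensions into an endomorphism of `quasiLocal π₀`
(`LocalizedSector.exists_toSector_eq`).

A morphism T : ρ ⟶ σ is encoded by the pair (T, ρ) in the monoid `TwistedPair`, whose product is
exactly the tensor product of morphisms. Equalities of functors become equations in this monoid
(`LocalizedEndo.functor_ext`). Pairs with orthogonal localizations commute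
(`LocalizedEndo.pair_commute_of_perp`); orthogonal enlargements enter only there, through
`LocalizedEndo.comp_apply_of_perp`. Strict monoidality, operadic composition and equivariance are
then reorderings of products of commuting elements.

For local constancy, the inclusion along U ⟶ V is full by Haag duality, and a unitary transporting ρ
to U lies in 𝔐(V), so it is a morphism linking ρ to an endomorphism localized in U. -/

theorem localRep_map (π : Astar.cocone.pt →⋆ₐ[ℂ] BddOp H₀) {U V : C} (f : U ⟶ V) (a : 𝔄.obj U) :
    localRep π V (CStarAlgCat.Hom.toStarAlgHom (𝔄.map f) a) = localRep π U a :=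
  congrArg π (DFunLike.congr_fun (F := 𝔄.obj U →⋆ₐ[ℂ] Astar.cocone.pt) (Astar.cocone.w f) a)

theorem localRep_commute (π : Astar.cocone.pt →⋆ₐ[ℂ] BddOp H₀) {U₁ U₂ V : C} (f₁ : U₁ ⟶ V)
    (f₂ : U₂ ⟶ V) (h : O.perp f₁ f₂) (a₁ : 𝔄.obj U₁) (a₂ : 𝔄.obj U₂) :
    Commute (localRep π U₁ a₁) (localRep π U₂ a₂) := by
  rw [← localRep_map π f₁, ← localRep_map π f₂]
  exact (𝔄.perp_commute f₁ f₂ h a₁ a₂).map (localRep π V)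

/-- The star centralizer asks for commutation with adjoints too; this is automatic because the range
of a *-homomorphism is closed under adjoints. -/
theorem commute_of_mem_bicommutant {U : C} {T S : BddOp H₀} (hT : T ∈ bicommutant π₀ U)
    (hS : ∀ a, Commute S (localRep π₀ U a)) : Commute S T := by
  rw [bicommutant, StarSubalgebra.mem_centralizer_iff] at hT
  refine (hT S ?_).1
  rw [SetLike.mem_coe, StarSubalgebra.mem_centralizer_iff]
  rintro _ ⟨a, rfl⟩
  refine ⟨(hS a).eq.symm, ?_⟩
  rw [← map_star]
  exact (hS (star a)).eq.symm

theorem bicommutant_commute {U₁ U₂ V : C} {f₁ : U₁ ⟶ V} {f₂ : U₂ ⟶ V} (h : O.perp f₁ f₂)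
    {T₁ T₂ : BddOp H₀} (h₁ : T₁ ∈ bicommutant π₀ U₁) (h₂ : T₂ ∈ bicommutant π₀ U₂) :
    Commute T₁ T₂ :=
  commute_of_mem_bicommutant h₂ fun a₂ => (commute_of_mem_bicommutant h₁ fun a₁ =>
    (localRep_commute π₀ f₁ f₂ h a₁ a₂).symm).symm

theorem HaagDuality.mem_bicommutant (hHaag : HaagDuality π₀) {U : C} {T : BddOp H₀}
    (hT : ∀ {U' V : C} (f' : U' ⟶ V) (f : U ⟶ V), O.perp f' f → ∀ a,
      Commute T (localRep π₀ U' a)) : T ∈ bicommutant π₀ U := by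
  rw [← SetLike.mem_coe, hHaag U]
  rintro U' V f' f h _ ⟨a, rfl⟩
  exact (hT f' f h a).eq.symm

theorem localRep_mem_quasiLocal (U : C) (a : 𝔄.obj U) : localRep π₀ U a ∈ quasiLocal π₀ :=
  bicommutant_le_quasiLocal π₀ U (localRep_mem_bicommutant π₀ U a)

theorem directed_bicommutant [IsFiltered C] : Directed (· ≤ ·) (bicommutant π₀) := fun U V =>
  ⟨IsFiltered.max U V, bicommutant_mono π₀ (IsFiltered.leftToMax U V),
    bicommutant_mono π₀ (IsFiltered.rightToMax U V)⟩

/-- Filteredness makes the bicommutants directed, so their supremum is their union; hence no closure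
of `P` under algebraic operations is needed. -/
theorem quasiLocal_induction [IsFiltered C] {P : quasiLocal π₀ → Prop}
    (hclosed : IsClosed {b | P b})
    (hP : ∀ (U : C) (b : quasiLocal π₀), (b : BddOp H₀) ∈ bicommutant π₀ U → P b)
    (b : quasiLocal π₀) : P b := by
  have : Nonempty C := IsFiltered.nonempty
  have hb : (b : BddOp H₀) ∈ closure ((⨆ U, bicommutant π₀ U : StarSubalgebra ℂ (BddOp H₀)) :
      Set (BddOp H₀)) := b.2
  have : b ∈ closure {b : quasiLocal π₀ | (b : BddOp H₀) ∈ ⨆ U, bicommutant π₀ U} := by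
    rw [closure_subtype]
    convert hb using 2
    ext x
    constructor
    · rintro ⟨y, hy, rfl⟩
      exact hy
    · exact fun hx => ⟨⟨x, StarSubalgebra.le_topologicalClosure _ hx⟩, hx, rfl⟩
  refine closure_minimal (fun b hb => ?_) hclosed this
  have hb' : (b : BddOp H₀) ∈ ((⨆ U, bicommutant π₀ U : StarSubalgebra ℂ (BddOp H₀)) :
      Set (BddOp H₀)) := hb
  rw [StarSubalgebra.coe_iSup_of_directed directed_bicommutant, Set.mem_iUnion] at hb'
  obtain ⟨U, hU⟩ := hb'
  exact hP U b hU

instance : IsClosed (quasiLocal π₀ : Set (BddOp H₀)) :=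
  StarSubalgebra.isClosed_topologicalClosure _

theorem continuous_starAlgHom {A B : Type*} [CStarAlgebra A] [CStarAlgebra B]
    (φ : A →⋆ₐ[ℂ] B) : Continuous φ :=
  AddMonoidHomClass.continuous_of_bound φ 1 fun a => by
    simpa using NonUnitalStarAlgHom.norm_apply_le φ a

/-! ### Localized endomorphisms -/

namespace LocalizedEndo

@[ext]
theorem ext {U : C} {ρ σ : LocalizedEndo π₀ U} (h : ρ.endo = σ.endo) : ρ = σ := by
  cases ρ; cases σ; congr

theorem endo_apply_of_perp {U U' V : C} (ρ : LocalizedEndo π₀ U) {f' : U' ⟶ V} {f : U ⟶ V}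
    (h : O.perp f' f) (b : quasiLocal π₀) (hb : (b : BddOp H₀) ∈ bicommutant π₀ U') :
    ρ.endo b = b :=
  DFunLike.congr_fun (ρ.localized f' f h) ⟨b, hb⟩

theorem endo_localRep_of_perp {U U' V : C} (ρ : LocalizedEndo π₀ U) {f' : U' ⟶ V} {f : U ⟶ V}
    (h : O.perp f' f) (a : 𝔄.obj U') :
    (ρ.endo ⟨localRep π₀ U' a, localRep_mem_quasiLocal U' a⟩ : BddOp H₀) = localRep π₀ U' a :=
  congrArg Subtype.val (ρ.endo_apply_of_perp h _ (localRep_mem_bicommutant π₀ U' a))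

/-- The unitary `v` intertwines the endomorphism `ρ` with the inclusion on all local algebras of
regions orthogonal to `W`. -/
def Transports (ρ : quasiLocal π₀ →⋆ₐ[ℂ] quasiLocal π₀) (W : C) (v : BddOp H₀) : Prop :=
  v ∈ unitary (BddOp H₀) ∧ ∀ {W' V : C} (f' : W' ⟶ V) (f : W ⟶ V), O.perp f' f →
    ∀ b : quasiLocal π₀, (b : BddOp H₀) ∈ bicommutant π₀ W' →
      v * (ρ b : BddOp H₀) = (b : BddOp H₀) * v

theorem exists_transports {U : C} (ρ : LocalizedEndo π₀ U) (W : C) :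
    ∃ v, Transports ρ.endo W v := by
  obtain ⟨v, hv, h⟩ := ρ.transportable W
  exact ⟨v, hv, fun f' f hp b hb => h f' f hp ⟨b, hb⟩⟩

/-- Transport to W makes ρ unitarily implemented on the algebras of regions orthogonal to W, the
source of all explicit formulas for ρ below. -/
theorem Transports.apply_eq {ρ : quasiLocal π₀ →⋆ₐ[ℂ] quasiLocal π₀} {W W' V : C} {v : BddOp H₀}
    (hv : Transports ρ W v) {f' : W' ⟶ V} {f : W ⟶ V} (h : O.perp f' f) (b : quasiLocal π₀)
    (hb : (b : BddOp H₀) ∈ bicommutant π₀ W') : (ρ b : BddOp H₀) = star v * b * v := by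
  rw [mul_assoc, ← hv.2 f' f h b hb, ← mul_assoc, Unitary.star_mul_self_of_mem hv.1, one_mul]

/-- On a region orthogonal to V, hence to both U and W, ρ is already the inclusion, so `v` commutes
with the local algebra there and Haag duality applies. -/
theorem Transports.mem_bicommutant (hHaag : HaagDuality π₀) {U W V : C} {ρ : LocalizedEndo π₀ U}
    {v : BddOp H₀} (hv : Transports ρ.endo W v) (g : U ⟶ V) (g' : W ⟶ V) :
    v ∈ bicommutant π₀ V := by
  refine hHaag.mem_bicommutant fun {V' Z} f' f h a => ?_
  have h₁ := hv.2 f' (g' ≫ f) (by simpa using O.precomp (𝟙 _) g' h)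
    ⟨localRep π₀ V' a, localRep_mem_quasiLocal V' a⟩ (localRep_mem_bicommutant π₀ V' a)
  rw [ρ.endo_localRep_of_perp (f' := f') (f := g ≫ f) (by simpa using O.precomp (𝟙 _) g h)] at h₁
  exact h₁

/-- Algebras orthogonal to U commute with `b` and are fixed by ρ, so they commute with ρ(b) as well.
-/
theorem endo_mem_bicommutant (hHaag : HaagDuality π₀) {U : C} (ρ : LocalizedEndo π₀ U)
    (b : quasiLocal π₀) (hb : (b : BddOp H₀) ∈ bicommutant π₀ U) :
    (ρ.endo b : BddOp H₀) ∈ bicommutant π₀ U := by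
  refine hHaag.mem_bicommutant fun {U' V} f' f h a => ?_
  rw [← ρ.endo_localRep_of_perp h a]
  have : Commute b ⟨localRep π₀ U' a, localRep_mem_quasiLocal U' a⟩ :=
    Subtype.ext (bicommutant_commute h (localRep_mem_bicommutant π₀ U' a) hb).eq.symm
  exact congrArg Subtype.val (this.map ρ.endo).eq

theorem intertwines {U : C} {ρ σ : LocalizedEndo π₀ U} (T : ρ ⟶ σ) (b : quasiLocal π₀) :
    op T * (ρ.endo b : BddOp H₀) = σ.endo b * op T :=
  (Subtype.property (p := (· ∈ (homs π₀ U).hom ρ σ)) T).2 b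

theorem hom_ext {U : C} {ρ σ : LocalizedEndo π₀ U} {S T : ρ ⟶ σ} (h : op S = op T) : S = T :=
  Subtype.ext h

theorem elt_mul_endo {U : C} {ρ σ : LocalizedEndo π₀ U} (T : ρ ⟶ σ) (b : quasiLocal π₀) :
    elt T * ρ.endo b = σ.endo b * elt T :=
  Subtype.ext (intertwines T b)

/-- The morphism given by an intertwiner in the bicommutant. -/
def homMk {U : C} {ρ σ : LocalizedEndo π₀ U} (T : BddOp H₀) (hT : T ∈ bicommutant π₀ U)
    (h : ∀ b, T * (ρ.endo b : BddOp H₀) = σ.endo b * T) : ρ ⟶ σ :=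
  Subtype.mk (p := (· ∈ (homs π₀ U).hom ρ σ)) T ⟨hT, h⟩

/-- An operator intertwining localized endomorphisms lies in the local bicommutant. -/
theorem mem_bicommutant_of_intertwines (hHaag : HaagDuality π₀) {U : C} {ρ σ : LocalizedEndo π₀ U}
    {T : BddOp H₀} (h : ∀ (W : C) (a : 𝔄.obj W),
      T * (ρ.endo ⟨localRep π₀ W a, localRep_mem_quasiLocal W a⟩ : BddOp H₀) =
        σ.endo ⟨localRep π₀ W a, localRep_mem_quasiLocal W a⟩ * T) : T ∈ bicommutant π₀ U := by
  refine hHaag.mem_bicommutant fun {U' V} f' f hp a => ?_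
  have := h U' a
  rwa [ρ.endo_localRep_of_perp hp, σ.endo_localRep_of_perp hp] at this

/-- An operator intertwining two transportable endomorphisms on the local algebras intertwines them
on the universal algebra. -/
theorem intertwines_of_localRep [IsFiltered C] (hO : O.HasComplements) {U : C}
    {ρ σ : LocalizedEndo π₀ U} {T : BddOp H₀} (h : ∀ (W : C) (a : 𝔄.obj W),
      T * (ρ.endo ⟨localRep π₀ W a, localRep_mem_quasiLocal W a⟩ : BddOp H₀) =
        σ.endo ⟨localRep π₀ W a, localRep_mem_quasiLocal W a⟩ * T) (b : quasiLocal π₀) :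
    T * (ρ.endo b : BddOp H₀) = σ.endo b * T := by
  refine quasiLocal_induction (P := fun b => T * (ρ.endo b : BddOp H₀) = σ.endo b * T)
    (isClosed_eq ?_ ?_) (fun W b hb => ?_) b
  · exact continuous_const.mul (continuous_subtype_val.comp (continuous_starAlgHom ρ.endo))
  · exact (continuous_subtype_val.comp (continuous_starAlgHom σ.endo)).mul continuous_const
  · obtain ⟨W', V, f', f, hp⟩ := hO W
    obtain ⟨v, hv⟩ := ρ.exists_transports W'
    obtain ⟨v', hv'⟩ := σ.exists_transports W'
    have hvv := Unitary.mul_star_self_of_mem hv.1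
    have hvv' := Unitary.mul_star_self_of_mem hv'.1
    have hs := Unitary.star_mul_self_of_mem hv.1
    have hs' := Unitary.star_mul_self_of_mem hv'.1
    have key : Commute (v' * T * star v) (b : BddOp H₀) := by
      refine commute_of_mem_bicommutant hb fun a => ?_
      have ha := h W a
      rw [hv.apply_eq (O.symm hp) _ (localRep_mem_bicommutant π₀ W a),
        hv'.apply_eq (O.symm hp) _ (localRep_mem_bicommutant π₀ W a)] at ha
      dsimp only at ha
      change v' * T * star v * localRep π₀ W a = localRep π₀ W a * (v' * T * star v)
      calc v' * T * star v * localRep π₀ W a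
          = v' * (T * (star v * localRep π₀ W a * v)) * star v := by
            simp only [mul_assoc, hvv, mul_one]
        _ = (v' * star v') * localRep π₀ W a * (v' * T * star v) := by
            rw [ha]; simp only [mul_assoc]
        _ = _ := by rw [hvv', one_mul]
    rw [hv.apply_eq (O.symm hp) _ hb, hv'.apply_eq (O.symm hp) _ hb]
    calc T * (star v * b * v) = (star v' * v') * T * (star v * b * v) := by rw [hs', one_mul]
      _ = star v' * ((v' * T * star v) * b) * v := by simp only [mul_assoc]
      _ = star v' * b * v' * T * (star v * v) := by rw [key.eq]; simp only [mul_assoc]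
      _ = star v' * b * v' * T := by rw [hs, mul_one]

end LocalizedEndo

end AQFT

/-! ### Pointwise limits of *-homomorphisms along a filtered category -/

open Filter Topology in
theorem exists_starAlgHom_tendsto {ι A B : Type*} [CStarAlgebra A] [CStarAlgebra B] (l : Filter ι)
    [l.NeBot] (φ : ι → A →⋆ₐ[ℂ] B) (h : ∀ a, ∃ b, Tendsto (fun i => φ i a) l (𝓝 b)) :
    ∃ ψ : A →⋆ₐ[ℂ] B, ∀ a, Tendsto (fun i => φ i a) l (𝓝 (ψ a)) := by
  choose ψ hψ using h
  refine ⟨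
    { toFun := ψ
      map_one' := tendsto_nhds_unique (hψ 1) (by simp)
      map_zero' := tendsto_nhds_unique (hψ 0) (by simp)
      map_add' := fun a b => tendsto_nhds_unique (hψ (a + b)) (by
        simpa using (hψ a).add (hψ b))
      map_mul' := fun a b => tendsto_nhds_unique (hψ (a * b)) (by
        simpa using (hψ a).mul (hψ b))
      commutes' := fun r => tendsto_nhds_unique (hψ _) (by simp [AlgHomClass.commutes])
      map_star' := fun a => tendsto_nhds_unique (hψ (star a)) (by
        simpa [map_star] using (hψ a).star) }, hψ⟩

open Filter Topology in
-- *-homomorphisms of C*-algebras are contractive, so `φ i a` stays uniformly close to a convergent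
-- family; completeness of B does the rest.
theorem isClosed_setOf_exists_tendsto_starAlgHom {ι A B : Type*} [CStarAlgebra A] [CStarAlgebra B]
    (l : Filter ι) [l.NeBot] (φ : ι → A →⋆ₐ[ℂ] B) :
    IsClosed {a | ∃ b, Tendsto (fun i => φ i a) l (𝓝 b)} := by
  refine isClosed_of_closure_subset fun a ha => ?_
  refine cauchy_map_iff_exists_tendsto.1 (Metric.cauchy_iff.2 ⟨inferInstance, fun ε hε => ?_⟩)
  obtain ⟨a', ⟨b, hb⟩, haa'⟩ := Metric.mem_closure_iff.1 ha (ε / 4) (by positivity)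
  refine ⟨Metric.ball b (ε / 2), ?_, fun x hx y hy => ?_⟩
  · rw [Filter.mem_map]
    filter_upwards [Metric.tendsto_nhds.1 hb (ε / 4) (by positivity)] with i hi
    have : dist (φ i a) (φ i a') ≤ dist a a' := by
      rw [dist_eq_norm, dist_eq_norm, ← map_sub]
      exact NonUnitalStarAlgHom.norm_apply_le (φ i) _
    have := dist_triangle (φ i a) (φ i a') b
    simp only [Set.mem_preimage, Metric.mem_ball]
    linarith
  · have := dist_triangle_right x y b
    simp only [Metric.mem_ball] at hx hy
    linarith

/-- The filter of sections of a filtered category. -/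
def CategoryTheory.IsFiltered.sections (C : Type u) [Category.{v} C] : Filter C :=
  ⨅ U : C, Filter.principal {V | Nonempty (U ⟶ V)}

theorem CategoryTheory.IsFiltered.mem_sections {C : Type u} [Category.{v} C] (U : C) :
    {V | Nonempty (U ⟶ V)} ∈ IsFiltered.sections C :=
  Filter.mem_iInf_of_mem U (Filter.mem_principal_self _)

instance CategoryTheory.IsFiltered.sections_neBot (C : Type u) [Category.{v} C] [IsFiltered C] :
    (IsFiltered.sections C).NeBot := by
  have : Nonempty C := IsFiltered.nonempty
  refine Filter.iInf_neBot_of_directed' (fun U V => ⟨IsFiltered.max U V, ?_, ?_⟩) fun U => ?_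
  · exact Filter.principal_mono.2 fun W ⟨g⟩ => ⟨IsFiltered.leftToMax U V ≫ g⟩
  · exact Filter.principal_mono.2 fun W ⟨g⟩ => ⟨IsFiltered.rightToMax U V ≫ g⟩
  · exact Filter.principal_neBot_iff.2 ⟨U, ⟨𝟙 U⟩⟩

namespace AQFT

variable {C : Type u} [Category.{v} C] {O : Orthogonality C} {𝔄 : AQFT.{u, v, w} O}
  {Astar : 𝔄.UniversalAlgebra}
  {H₀ : Type w} [NormedAddCommGroup H₀] [InnerProductSpace ℂ H₀] [CompleteSpace H₀]
  {π₀ : Astar.cocone.pt →⋆ₐ[ℂ] BddOp H₀}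

/-! ### Endomorphisms and representations -/

/-- The local representations with values in the universal algebra of bicommutants. -/
def quasiLocalCocone (π₀ : Astar.cocone.pt →⋆ₐ[ℂ] BddOp H₀) : Limits.Cocone 𝔄.toFunctor where
  pt := ⟨quasiLocal π₀⟩
  ι :=
    { app := fun U => (inclQuasiLocal π₀ U).comp (localRepBi π₀ U)
      naturality := fun U V f => by
        refine StarAlgHom.ext (A := 𝔄.obj U) (B := quasiLocal π₀) fun a => ?_
        exact Subtype.ext (localRep_map π₀ f a) }

/-- The representation `π₀` with values in the universal algebra of bicommutants. -/
def toQuasiLocal (π₀ : Astar.cocone.pt →⋆ₐ[ℂ] BddOp H₀) : Astar.cocone.pt →⋆ₐ[ℂ] quasiLocal π₀ :=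
  CStarAlgCat.Hom.toStarAlgHom (Astar.isColimit.desc (quasiLocalCocone π₀))

theorem toQuasiLocal_toUniversal (U : C) (a : 𝔄.obj U) :
    toQuasiLocal π₀ (toUniversal Astar U a) =
      ⟨localRep π₀ U a, localRep_mem_quasiLocal U a⟩ :=
  DFunLike.congr_fun (F := 𝔄.obj U →⋆ₐ[ℂ] quasiLocal π₀)
    (Astar.isColimit.fac (quasiLocalCocone π₀) U) a

theorem rep_ext {π π' : Astar.cocone.pt →⋆ₐ[ℂ] BddOp H₀}
    (h : ∀ (W : C) (a : 𝔄.obj W), localRep π W a = localRep π' W a) : π = π' :=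
  Astar.isColimit.hom_ext (W := (⟨BddOp H₀⟩ : CStarAlgCat.{w})) (f := π) (f' := π') fun W =>
    StarAlgHom.ext (A := 𝔄.obj W) (B := BddOp H₀) (h W)

/-- The representation `ρ ∘ π₀`. -/
def LocalizedEndo.toRep {U : C} (ρ : LocalizedEndo π₀ U) : Astar.cocone.pt →⋆ₐ[ℂ] BddOp H₀ :=
  (quasiLocal π₀).subtype.comp (ρ.endo.comp (toQuasiLocal π₀))

theorem LocalizedEndo.localRep_toRep {U : C} (ρ : LocalizedEndo π₀ U) (W : C) (a : 𝔄.obj W) :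
    localRep ρ.toRep W a = ρ.endo ⟨localRep π₀ W a, localRep_mem_quasiLocal W a⟩ :=
  congrArg (fun b => (ρ.endo b : BddOp H₀)) (toQuasiLocal_toUniversal W a)

/-- The sector `ρ ∘ π₀`. -/
def LocalizedEndo.toSector {U : C} (ρ : LocalizedEndo π₀ U) : LocalizedSector π₀ U where
  rep := ρ.toRep
  isSector W := by
    obtain ⟨v, hv⟩ := ρ.exists_transports W
    refine ⟨Unitary.linearIsometryEquiv ⟨v, hv.1⟩, fun {W' V} f' f h a x => ?_⟩
    rw [ρ.localRep_toRep]
    exact DFunLike.congr_fun (hv.2 f' f h ⟨localRep π₀ W' a, localRep_mem_quasiLocal W' a⟩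
      (localRep_mem_bicommutant π₀ W' a)) x
  localized f' f h := StarAlgHom.ext fun a => by
    rw [ρ.localRep_toRep, ρ.endo_localRep_of_perp h]

@[ext]
theorem LocalizedSector.ext {U : C} {π π' : LocalizedSector π₀ U} (h : π.rep = π'.rep) :
    π = π' := by
  cases π; cases π'; congr

/-- The functor `ρ ↦ ρ ∘ π₀` from endomorphisms to sectors. -/
def comparison (π₀ : Astar.cocone.pt →⋆ₐ[ℂ] BddOp H₀) (U : C) :
    LocalizedEndo π₀ U ⥤ LocalizedSector π₀ U where
  obj ρ := ρ.toSector
  map T := ⟨LocalizedEndo.op T, fun a => LocalizedEndo.intertwines T (toQuasiLocal π₀ a)⟩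
  map_id _ := rfl
  map_comp _ _ := rfl

theorem LocalizedSector.intertwines {U : C} {π π' : LocalizedSector π₀ U} (T : π ⟶ π')
    (a : Astar.cocone.pt) : op T * π.rep a = π'.rep a * op T :=
  Subtype.property (p := (· ∈ (homs π₀ U).hom π π')) T a

theorem intertwines_of_rep [IsFiltered C] (hO : O.HasComplements) {U : C} {ρ σ : LocalizedEndo π₀ U}
    {T : BddOp H₀} (h : ∀ a, T * ρ.toRep a = σ.toRep a * T) (b : quasiLocal π₀) :
    T * (ρ.endo b : BddOp H₀) = σ.endo b * T := by
  refine LocalizedEndo.intertwines_of_localRep hO (fun W a => ?_) b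
  rw [← ρ.localRep_toRep, ← σ.localRep_toRep]
  exact h _

theorem mem_bicommutant_of_rep (hHaag : HaagDuality π₀) {U : C} {ρ σ : LocalizedEndo π₀ U}
    {T : BddOp H₀} (h : ∀ a, T * ρ.toRep a = σ.toRep a * T) : T ∈ bicommutant π₀ U := by
  refine LocalizedEndo.mem_bicommutant_of_intertwines hHaag (ρ := ρ) (σ := σ) fun W a => ?_
  rw [← ρ.localRep_toRep, ← σ.localRep_toRep]
  exact h _

/-- An operator intertwining `π` and `π₀` on a local algebra intertwines the extension of `π` to
the bicommutant, which is implemented by a unitary, and the inclusion. -/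
theorem mul_conj_eq_of_localRep {π : Astar.cocone.pt →⋆ₐ[ℂ] BddOp H₀} {W : C} {v S b : BddOp H₀}
    (hv : v ∈ unitary (BddOp H₀)) (hvπ : ∀ a, v * localRep π W a = localRep π₀ W a * v)
    (hS : ∀ a, S * localRep π W a = localRep π₀ W a * S) (hb : b ∈ bicommutant π₀ W) :
    S * (star v * b * v) = b * S := by
  have hvv := Unitary.mul_star_self_of_mem hv
  have hs := Unitary.star_mul_self_of_mem hv
  have key : Commute (S * star v) b := by
    refine commute_of_mem_bicommutant hb fun a => ?_
    have : star v * localRep π₀ W a = localRep π W a * star v := by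
      calc star v * localRep π₀ W a = star v * (localRep π₀ W a * v) * star v := by
            rw [mul_assoc, mul_assoc, hvv, mul_one]
        _ = _ := by rw [← hvπ, ← mul_assoc, hs, one_mul]
    change S * star v * _ = _ * (S * star v)
    rw [mul_assoc, this, ← mul_assoc, hS, mul_assoc]
  calc S * (star v * b * v) = (S * star v * b) * v := by simp only [mul_assoc]
    _ = b * S * (star v * v) := by rw [key.eq]; simp only [mul_assoc]
    _ = b * S := by rw [hs, mul_one]

theorem LocalizedSector.exists_unitary {U : C} (π : LocalizedSector π₀ U) (W : C) :
    ∃ v ∈ unitary (BddOp H₀), ∀ {W' V : C} (f' : W' ⟶ V) (f : W ⟶ V), O.perp f' f →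
      ∀ a : 𝔄.obj W', v * localRep π.rep W' a = localRep π₀ W' a * v := by
  obtain ⟨v, hv⟩ := π.isSector W
  exact ⟨_, (Unitary.linearIsometryEquiv.symm v).2, fun f' f h a =>
    ContinuousLinearMap.ext fun x => hv f' f h a x⟩

open Filter Topology in
-- The extension is b ↦ v* b v on each 𝔐(W), with v implementing π on 𝔄(W). Haag duality is needed
-- to keep its values in `quasiLocal π₀`.
theorem LocalizedSector.exists_toSector_eq [IsFiltered C] (hO : O.HasComplements)
    (hHaag : HaagDuality π₀) {U : C} (π : LocalizedSector π₀ U) :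
    ∃ ρ : LocalizedEndo π₀ U, ρ.toRep = π.rep := by
  -- Apply the sector condition at a region W' orthogonal to W, so that W itself is among the
  -- regions orthogonal to W'.
  have hex : ∀ W : C, ∃ v ∈ unitary (BddOp H₀), ∀ a : 𝔄.obj W,
      v * localRep π.rep W a = localRep π₀ W a * v := by
    intro W
    obtain ⟨W', V, f', f, h⟩ := hO W
    obtain ⟨v, hv, hv'⟩ := π.exists_unitary W'
    exact ⟨v, hv, hv' f f' (O.symm h)⟩
  choose v hv hvπ using hex
  have hvv := fun W => Unitary.mul_star_self_of_mem (hv W)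
  have hs := fun W => Unitary.star_mul_self_of_mem (hv W)
  -- Both `v W` and `v X` intertwine π with π₀ on 𝔄(X), so their conjugations agree on 𝔐(X).
  have hcompat : ∀ {X W : C} (_ : X ⟶ W) {b : BddOp H₀}, b ∈ bicommutant π₀ X →
      star (v W) * b * v W = star (v X) * b * v X := by
    intro X W g b hb
    have := mul_conj_eq_of_localRep (hv X) (hvπ X) (S := v W) (fun a => by
      rw [← localRep_map π.rep g, ← localRep_map π₀ g, hvπ W]) hb
    rw [mul_assoc, ← this, ← mul_assoc, hs, one_mul]
  -- Each `φ W` is defined on the whole algebra but is meaningful only on 𝔐(W). Along the filter of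
  -- sections it is eventually constant on every 𝔐(X), so the pointwise limit performs the gluing.
  let φ : C → quasiLocal π₀ →⋆ₐ[ℂ] BddOp H₀ := fun W =>
    ((Unitary.conjStarAlgAut ℂ (BddOp H₀) (star ⟨v W, hv W⟩) : BddOp H₀ →⋆ₐ[ℂ] BddOp H₀)).comp
      (quasiLocal π₀).subtype
  have hφ : ∀ W b, φ W b = star (v W) * b * v W := fun W b => by
    simp [φ, Unitary.conjStarAlgAut_apply]
  have hconst : ∀ (X : C) (b : quasiLocal π₀), (b : BddOp H₀) ∈ bicommutant π₀ X →
      Tendsto (fun W => φ W b) (IsFiltered.sections C) (𝓝 (star (v X) * b * v X)) := by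
    intro X b hb
    refine tendsto_nhds_of_eventually_eq ?_
    filter_upwards [IsFiltered.mem_sections X] with W ⟨g⟩
    rw [hφ, hcompat g hb]
  obtain ⟨ψ, hψ⟩ := exists_starAlgHom_tendsto (IsFiltered.sections C) φ
    (quasiLocal_induction (isClosed_setOf_exists_tendsto_starAlgHom _ _)
      fun X b hb => ⟨_, hconst X b hb⟩)
  have hψ' : ∀ (X : C) (b : quasiLocal π₀), (b : BddOp H₀) ∈ bicommutant π₀ X →
      ψ b = star (v X) * b * v X := fun X b hb => tendsto_nhds_unique (hψ b) (hconst X b hb)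
  have hmem : ∀ b, ψ b ∈ quasiLocal π₀ := by
    refine quasiLocal_induction ?_ fun X b hb => ?_
    · exact (StarSubalgebra.isClosed_topologicalClosure _).preimage (continuous_starAlgHom ψ)
    -- Enlarge X to a region above U as well: regions orthogonal to it are orthogonal to U, so π
    -- agrees with π₀ there.
    · have hb' := bicommutant_mono π₀ (IsFiltered.rightToMax U X) hb
      rw [hψ' _ b hb']
      set V := IsFiltered.max U X
      refine bicommutant_le_quasiLocal π₀ V (hHaag.mem_bicommutant fun {V' Z} f' f h a' => ?_)
      have hπ : localRep π₀ V' a' = localRep π.rep V' a' :=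
        (DFunLike.congr_fun (π.localized f' (IsFiltered.leftToMax U X ≫ f)
          (by simpa using O.precomp (𝟙 _) (IsFiltered.leftToMax U X) h)) a').symm
      have hconj : ∀ a, localRep π₀ V a = v V * localRep π.rep V a * star (v V) := fun a => by
        rw [hvπ, mul_assoc, hvv, mul_one]
      -- Locality of π, conjugated by `v V`, gives commutation with π₀(𝔄(V)), hence with `b`;
      -- conjugating back gives commutation of π(a') with ψ(b).
      have key : Commute (v V * localRep π.rep V' a' * star (v V)) (b : BddOp H₀) := by
        refine commute_of_mem_bicommutant hb' fun a => ?_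
        have hc := localRep_commute π.rep f' f h a' a
        rw [hconj]
        simpa [Unitary.conjStarAlgAut_apply] using
          hc.map (Unitary.conjStarAlgAut ℂ (BddOp H₀) ⟨v V, hv V⟩)
      have key' : Commute (star (v V) * (v V * localRep π.rep V' a' * star (v V)) * v V)
          (star (v V) * (b : BddOp H₀) * v V) := by
        simpa [Unitary.conjStarAlgAut_apply] using
          key.map (Unitary.conjStarAlgAut ℂ (BddOp H₀) (star ⟨v V, hv V⟩))
      rw [hπ]
      convert key'.symm using 1
      simp only [← mul_assoc]
      rw [hs, one_mul, mul_assoc, hs, mul_one]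
  let ρ : LocalizedEndo π₀ U :=
    { endo := ψ.codRestrict (quasiLocal π₀) hmem
      transportable := fun W => by
        obtain ⟨S, hS, hS'⟩ := π.exists_unitary W
        refine ⟨S, hS, fun {W' V} f' f h b => ?_⟩
        change S * ψ _ = _
        rw [hψ' W' _ b.2]
        exact mul_conj_eq_of_localRep (hv W') (hvπ W') (hS' f' f h) b.2
      localized := fun {U' V} f' f h => StarAlgHom.ext fun b => Subtype.ext <| by
        change ψ _ = (b : BddOp H₀)
        rw [hψ' U' _ b.2]
        have := mul_conj_eq_of_localRep (hv U') (hvπ U') (S := 1) (fun a => by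
          rw [π.localized f' f h, one_mul, mul_one]) b.2
        rwa [one_mul, mul_one] at this }
  refine ⟨ρ, rep_ext fun W a => ?_⟩
  rw [ρ.localRep_toRep]
  change ψ _ = _
  rw [hψ' W _ (localRep_mem_bicommutant π₀ W a)]
  change star (v W) * localRep π₀ W a * v W = _
  rw [mul_assoc, ← hvπ, ← mul_assoc, hs, one_mul]

theorem isComparison_comparison [IsFiltered C] (hO : O.HasComplements) (hHaag : HaagDuality π₀)
    (U : C) : IsComparison (comparison π₀ U) where
  obj_apply ρ W a := ρ.localRep_toRep W a
  map_op _ := rfl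
  bijective_obj := by
    refine ⟨fun ρ σ h => ?_, fun π => ?_⟩
    · have hrep : ρ.toRep = σ.toRep := congrArg LocalizedSector.rep h
      refine LocalizedEndo.ext (StarAlgHom.ext fun b => Subtype.ext ?_)
      -- With T = 1, intertwining says that two endomorphisms agreeing after π₀ agree everywhere.
      simpa using intertwines_of_rep hO (ρ := ρ) (σ := σ) (T := 1) (by simp [hrep]) b
    · obtain ⟨ρ, hρ⟩ := π.exists_toSector_eq hO hHaag
      refine ⟨ρ, ?_⟩
      exact LocalizedSector.ext hρ
  bijective_map ρ σ := by
    refine ⟨fun S T h => LocalizedEndo.hom_ext (congrArg LocalizedSector.op h), fun T => ?_⟩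
    have hT := LocalizedSector.intertwines T
    exact ⟨LocalizedEndo.homMk (LocalizedSector.op T) (mem_bicommutant_of_rep hHaag hT)
      (intertwines_of_rep hO hT), rfl⟩

end AQFT

/-! ### The monoid encoding tensor products of intertwiners -/

/-- Pairs of an element `T` and an endomorphism `ρ` of a C*-algebra, multiplied by
`(T, ρ) (T', ρ') = (T ρ(T'), ρ ρ')`. -/
@[ext]
structure TwistedPair (A : Type w) [CStarAlgebra A] where
  elt : A
  endo : A →⋆ₐ[ℂ] A

namespace TwistedPair

variable {A : Type w} [CStarAlgebra A]

/-- This is a semidirect product: endomorphisms act on the multiplicative monoid of A. -/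
instance : Monoid (TwistedPair A) where
  mul p q := ⟨p.elt * p.endo q.elt, p.endo.comp q.endo⟩
  one := ⟨1, StarAlgHom.id ℂ A⟩
  mul_assoc p q r := TwistedPair.ext
    (show p.elt * p.endo q.elt * p.endo (q.endo r.elt) = p.elt * p.endo (q.elt * q.endo r.elt) by
      rw [map_mul, mul_assoc]) rfl
  one_mul p := TwistedPair.ext (one_mul p.elt) rfl
  mul_one p := TwistedPair.ext
    (show p.elt * p.endo 1 = p.elt by rw [map_one, mul_one]) rfl

end TwistedPair

namespace AQFT

variable {C : Type u} [Category.{v} C] {O : Orthogonality C} {𝔄 : AQFT.{u, v, w} O}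
  {Astar : 𝔄.UniversalAlgebra}
  {H₀ : Type w} [NormedAddCommGroup H₀] [InnerProductSpace ℂ H₀] [CompleteSpace H₀]
  {π₀ : Astar.cocone.pt →⋆ₐ[ℂ] BddOp H₀}

namespace LocalizedEndo

/-! ### Morphisms as pairs -/

@[simp]
theorem op_comp {U : C} {ρ σ τ : LocalizedEndo π₀ U} (S : ρ ⟶ σ) (T : σ ⟶ τ) :
    op (S ≫ T) = op T * op S := rfl

/-- The pair of the element underlying a morphism and the endomorphism which is its source. -/
def pair {U : C} {ρ σ : LocalizedEndo π₀ U} (T : ρ ⟶ σ) : TwistedPair (quasiLocal π₀) :=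
  ⟨elt T, ρ.endo⟩

theorem heq_of_op {U : C} {ρ σ ρ' σ' : LocalizedEndo π₀ U} {T : ρ ⟶ σ} {T' : ρ' ⟶ σ'}
    (h : ρ = ρ') (k : σ = σ') (hT : op T = op T') : HEq T T' := by
  subst h k
  exact heq_of_eq (hom_ext hT)

/-- A pair determines the operator and the source; targets are recovered as sources of identities.
Strict equalities of functors thus avoid any transport along equalities of objects. -/
theorem functor_ext {D : Type*} [Category D] {U : C} {F G : D ⥤ LocalizedEndo π₀ U}
    (h : ∀ {x y : D} (f : x ⟶ y), pair (F.map f) = pair (G.map f)) : F = G := by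
  have hobj : ∀ x, F.obj x = G.obj x := fun x => LocalizedEndo.ext
    (congrArg TwistedPair.endo (h (𝟙 x)))
  exact Functor.hext hobj fun x y f => heq_of_op (hobj x) (hobj y)
    (congrArg (fun p : TwistedPair (quasiLocal π₀) => (p.elt : BddOp H₀)) (h f))

/-! ### The composition product -/

/-- The composition of localized endomorphisms. -/
def tensorObj [IsFiltered C] (hHaag : HaagDuality π₀) {U : C} (ρ σ : LocalizedEndo π₀ U) :
    LocalizedEndo π₀ U where
  endo := ρ.endo.comp σ.endo
  transportable W := by
    obtain ⟨v, hv⟩ := ρ.exists_transports W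
    obtain ⟨v', hv'⟩ := σ.exists_transports W
    -- The composite is transported by v ρ(v'). For ρ(v') to make sense, v' must lie in `quasiLocal
    -- π₀`: Haag duality puts it in the bicommutant of a region above U and W.
    let x : quasiLocal π₀ := ⟨v', bicommutant_le_quasiLocal π₀ _
      (hv'.mem_bicommutant hHaag (IsFiltered.leftToMax U W) (IsFiltered.rightToMax U W))⟩
    have hx : x ∈ unitary (quasiLocal π₀) :=
      ⟨Subtype.ext (Unitary.star_mul_self_of_mem hv'.1),
        Subtype.ext (Unitary.mul_star_self_of_mem hv'.1)⟩
    have hx' : (ρ.endo x : BddOp H₀) ∈ unitary (BddOp H₀) :=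
      Unitary.map_mem ((quasiLocal π₀).subtype.comp ρ.endo) hx
    refine ⟨v * ρ.endo x, mul_mem hv.1 hx', fun {W' V} f' f h b => ?_⟩
    have h₁ : x * σ.endo (inclQuasiLocal π₀ W' b) = inclQuasiLocal π₀ W' b * x :=
      Subtype.ext (hv'.2 f' f h _ b.2)
    have h₂ := congrArg (fun y => (ρ.endo y : BddOp H₀)) h₁
    simp only [map_mul, MulMemClass.coe_mul] at h₂
    change v * _ * (ρ.endo (σ.endo _) : BddOp H₀) = _
    rw [mul_assoc, h₂, ← mul_assoc, hv.2 f' f h _ b.2, mul_assoc]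
    rfl
  localized f' f h := by rw [StarAlgHom.comp_assoc, σ.localized f' f h, ρ.localized f' f h]

/-- The identity endomorphism. -/
def tensorUnit (π₀ : Astar.cocone.pt →⋆ₐ[ℂ] BddOp H₀) (U : C) : LocalizedEndo π₀ U where
  endo := StarAlgHom.id ℂ _
  transportable _ := ⟨1, one_mem _, fun _ _ _ b => (one_mul _).trans (mul_one (b : BddOp H₀)).symm⟩
  localized _ _ _ := rfl

/-- The product `T ∘ ρ(T')` of morphisms `T : ρ ⟶ σ` and `T' : ρ' ⟶ σ'`. -/
def tensorHom [IsFiltered C] (hHaag : HaagDuality π₀) {U : C} {ρ σ ρ' σ' : LocalizedEndo π₀ U}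
    (T : ρ ⟶ σ) (T' : ρ' ⟶ σ') : tensorObj hHaag ρ ρ' ⟶ tensorObj hHaag σ σ' :=
  homMk (op T * ρ.endo (elt T'))
    (mul_mem (op_mem T) (ρ.endo_mem_bicommutant hHaag _ (op_mem T'))) fun b => by
      change _ * (ρ.endo (ρ'.endo b) : BddOp H₀) = (σ.endo (σ'.endo b) : BddOp H₀) * _
      have h := congrArg (fun y => (ρ.endo y : BddOp H₀)) (elt_mul_endo T' b)
      simp only [map_mul, MulMemClass.coe_mul] at h
      rw [mul_assoc, h, ← mul_assoc, intertwines, mul_assoc]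

theorem op_tensorHom [IsFiltered C] (hHaag : HaagDuality π₀) {U : C}
    {ρ σ ρ' σ' : LocalizedEndo π₀ U} (T : ρ ⟶ σ) (T' : ρ' ⟶ σ') :
    op (tensorHom hHaag T T') = op T * ρ.endo (elt T') := rfl

/-- The functor given by the composition of localized endomorphisms. -/
def tensorFunctor [IsFiltered C] (hHaag : HaagDuality π₀) (U : C) :
    LocalizedEndo π₀ U × LocalizedEndo π₀ U ⥤ LocalizedEndo π₀ U where
  obj p := tensorObj hHaag p.1 p.2
  map f := tensorHom hHaag f.1 f.2
  map_id p := hom_ext (by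
    rw [op_tensorHom]
    change (1 : BddOp H₀) * (p.1.endo 1 : BddOp H₀) = 1
    simp)
  map_comp {p q r} f g := hom_ext (by
    rw [op_comp, op_tensorHom, op_tensorHom, op_tensorHom]
    change op g.1 * op f.1 * (p.1.endo (elt g.2 * elt f.2) : BddOp H₀) = _
    rw [map_mul, MulMemClass.coe_mul, mul_assoc, ← mul_assoc (op f.1), intertwines]
    simp only [mul_assoc])

/-- The strict monoidal structure given by composition of endomorphisms. -/
@[reducible]
def monoidalStructure [IsFiltered C] (hHaag : HaagDuality π₀) (U : C) :
    StrictMonoidalCStar (LocalizedEndo π₀ U) where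
  tensor := tensorFunctor hHaag U
  unit := tensorUnit π₀ U
  add_tensor f g h := hom_ext (add_mul _ _ _)
  tensor_add {x x' y y'} f g h := hom_ext (by
    change op f * (x.endo (elt g + elt h) : BddOp H₀) =
      op f * (x.endo (elt g) : BddOp H₀) + op f * (x.endo (elt h) : BddOp H₀)
    rw [map_add, AddMemClass.coe_add, mul_add])
  smul_tensor c f h := hom_ext (smul_mul_assoc _ _ _)
  tensor_smul {x x' y y'} c f h := hom_ext (by
    change op f * (x.endo (c • elt h) : BddOp H₀) = c • (op f * (x.endo (elt h) : BddOp H₀))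
    rw [map_smul, ← mul_smul_comm]
    rfl)
  dagger_tensor {x x' y y'} f h := hom_ext (by
    change star (op f) * (x'.endo (star (elt h)) : BddOp H₀) =
      star (op f * (x.endo (elt h) : BddOp H₀))
    rw [intertwines, star_mul, map_star]
    rfl)
  -- The strict coherence laws are the monoid laws of `TwistedPair`.
  assoc := functor_ext fun f => mul_assoc (pair f.1.1) (pair f.1.2) (pair f.2)
  unit_tensor := functor_ext fun f => one_mul (pair f)
  tensor_unit := functor_ext fun f => mul_one (pair f)

theorem isCompositionProduct_monoidalStructure [IsFiltered C] (hHaag : HaagDuality π₀) (U : C) :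
    IsCompositionProduct (monoidalStructure hHaag U) where
  tensor_obj _ _ := rfl
  tensor_map _ _ := rfl
  unit_endo := rfl

/-! ### Orthogonally localized endomorphisms -/

/-- On 𝔐(V), ρ and σ are conjugations by v₁ ∈ 𝔐(V₁) and v₂ ∈ 𝔐(V₂), their transports to U₁' and U₂'.
As V₁ and V₂ are orthogonal, v₁ and v₂ commute, ρ fixes v₂ and σ fixes v₁; both composites are
conjugation by v₁v₂. -/
theorem comp_apply_of_perp (hHaag : HaagDuality π₀) (hO : O.HasOrthogonalEnlargements)
    {U₁ U₂ V : C} {f₁ : U₁ ⟶ V} {f₂ : U₂ ⟶ V} (h : O.perp f₁ f₂) (ρ : LocalizedEndo π₀ U₁)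
    (σ : LocalizedEndo π₀ U₂) (b : quasiLocal π₀) (hb : (b : BddOp H₀) ∈ bicommutant π₀ V) :
    ρ.endo (σ.endo b) = σ.endo (ρ.endo b) := by
  obtain ⟨W, V₁, V₂, U₁', U₂', k, k₁, k₂, g₁, g₁', g₂, g₂', hk, -, -, h₁, h₂⟩ := hO f₁ f₂ h
  obtain ⟨v₁, hv₁⟩ := ρ.exists_transports U₁'
  obtain ⟨v₂, hv₂⟩ := σ.exists_transports U₂'
  have hm₁ := hv₁.mem_bicommutant hHaag g₁ g₁'
  have hm₂ := hv₂.mem_bicommutant hHaag g₂ g₂'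
  let x₁ : quasiLocal π₀ := ⟨v₁, bicommutant_le_quasiLocal π₀ _ hm₁⟩
  let x₂ : quasiLocal π₀ := ⟨v₂, bicommutant_le_quasiLocal π₀ _ hm₂⟩
  have hx : x₁ * x₂ = x₂ * x₁ := Subtype.ext (bicommutant_commute hk hm₁ hm₂)
  have hx₁ : σ.endo x₁ = x₁ := σ.endo_apply_of_perp (f' := k₁) (f := g₂ ≫ k₂)
    (by simpa using O.precomp (𝟙 _) g₂ hk) _ hm₁
  have hx₂ : ρ.endo x₂ = x₂ := ρ.endo_apply_of_perp (f' := k₂) (f := g₁ ≫ k₁)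
    (by simpa using O.precomp (𝟙 _) g₁ (O.symm hk)) _ hm₂
  have hρ : ρ.endo b = star x₁ * b * x₁ := Subtype.ext (hv₁.apply_eq (O.symm h₁) b hb)
  have hσ : σ.endo b = star x₂ * b * x₂ := Subtype.ext (hv₂.apply_eq (O.symm h₂) b hb)
  have hs : star x₂ * star x₁ = star x₁ * star x₂ := by rw [← star_mul, ← star_mul, hx]
  rw [hσ, hρ, map_mul, map_mul, map_star, map_mul, map_mul, map_star, hρ, hσ, hx₁, hx₂]
  simp only [← mul_assoc, hs]
  simp only [mul_assoc, hx]

theorem endo_comm_of_perp [IsFiltered C] (hHaag : HaagDuality π₀)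
    (hO : O.HasOrthogonalEnlargements) {U₁ U₂ V : C} {f₁ : U₁ ⟶ V} {f₂ : U₂ ⟶ V}
    (h : O.perp f₁ f₂) (ρ : LocalizedEndo π₀ U₁) (σ : LocalizedEndo π₀ U₂) :
    ρ.endo.comp σ.endo = σ.endo.comp ρ.endo := by
  refine StarAlgHom.ext (quasiLocal_induction (isClosed_eq ?_ ?_) fun X b hb => ?_)
  · exact continuous_starAlgHom _
  · exact continuous_starAlgHom _
  -- Orthogonality survives postcomposition, so V may be replaced by a region also containing X.
  · exact comp_apply_of_perp hHaag hO (O.postcomp (IsFiltered.leftToMax V X) h) ρ σ b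
      (bicommutant_mono π₀ (IsFiltered.rightToMax V X) hb)

/-- Each endomorphism fixes the other intertwiner, and the intertwiners commute by locality of 𝔐. -/
theorem pair_commute_of_perp [IsFiltered C] (hHaag : HaagDuality π₀)
    (hO : O.HasOrthogonalEnlargements) {U₁ U₂ V : C} {f₁ : U₁ ⟶ V} {f₂ : U₂ ⟶ V}
    (h : O.perp f₁ f₂) {ρ ρ' : LocalizedEndo π₀ U₁} {σ σ' : LocalizedEndo π₀ U₂} (S : ρ ⟶ ρ')
    (T : σ ⟶ σ') : Commute (pair S) (pair T) := by
  refine TwistedPair.ext ?_ (endo_comm_of_perp hHaag hO h ρ σ)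
  change elt S * ρ.endo (elt T) = elt T * σ.endo (elt S)
  rw [ρ.endo_apply_of_perp (O.symm h) _ (op_mem T), σ.endo_apply_of_perp h _ (op_mem S)]
  exact Subtype.ext (bicommutant_commute h (op_mem S) (op_mem T))

end LocalizedEndo

end AQFT

/-! ### Products of commuting families -/

/-- This is the interchange law behind strict monoidality. Only distinct indices must commute, since
`p i` and `q i` come from the same region. -/
theorem List.prod_ofFn_mul_of_commute {M : Type*} [Monoid M] :
    ∀ {n : ℕ} (p q : Fin n → M), (∀ i j, i ≠ j → Commute (p i) (q j)) →
      (List.ofFn fun i => p i * q i).prod = (List.ofFn p).prod * (List.ofFn q).prod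
  | 0, _, _, _ => by simp
  | n + 1, p, q, h => by
    have hc : Commute (List.ofFn fun i : Fin n => p i.succ).prod (q 0) := by
      refine Commute.list_prod_left _ _ fun x hx => ?_
      obtain ⟨i, rfl⟩ := (List.mem_ofFn' _ _).1 hx
      exact h _ _ (Fin.succ_ne_zero i)
    rw [List.ofFn_succ, List.ofFn_succ, List.ofFn_succ, List.prod_cons, List.prod_cons,
      List.prod_cons, List.prod_ofFn_mul_of_commute _ _ fun i j hij =>
        h i.succ j.succ fun e => hij (Fin.succ_injective n e)]
    simp only [mul_assoc]
    rw [← mul_assoc (q 0), ← hc.eq, mul_assoc]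

theorem List.prod_ofFn_comp_perm_of_commute {M : Type*} [Monoid M] {n : ℕ} (p : Fin n → M)
    (σ : Equiv.Perm (Fin n)) (h : ∀ i j, i ≠ j → Commute (p i) (p j)) :
    (List.ofFn fun i => p (σ i)).prod = (List.ofFn p).prod :=
  (List.Perm.prod_eq' (Equiv.Perm.ofFn_comp_perm σ p).symm
    (List.pairwise_ofFn.2 fun i j hij => h i j hij.ne)).symm

/-- A statement up to permutation suffices for commuting factors, and makes the ordering chosen by
`finSigmaFinEquiv` irrelevant. -/
theorem List.ofFn_finSigmaFinEquiv_perm {α : Type*} {m : ℕ} {k : Fin m → ℕ}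
    (q : (i : Fin m) × Fin (k i) → α) :
    (List.ofFn fun j => q (finSigmaFinEquiv.symm j)).Perm
      (List.ofFn fun i => List.ofFn fun l => q ⟨i, l⟩).flatten := by
  rw [← Multiset.coe_eq_coe, ← Multiset.coe_join, List.map_ofFn, ← Fin.univ_val_map,
    ← Fin.univ_val_map]
  have h : (Finset.univ : Finset (Fin (∑ i, k i))).val.map finSigmaFinEquiv.symm =
      (Finset.univ : Finset ((i : Fin m) × Fin (k i))).val :=
    Multiset.map_univ_val_equiv _
  have h' := congrArg (Multiset.map q) h
  rw [Multiset.map_map] at h'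
  refine h'.trans ?_
  rw [← Finset.univ_sigma_univ]
  change Multiset.map q (Multiset.bind Finset.univ.val fun i => Finset.univ.val.map (Sigma.mk i)) = _
  rw [Multiset.map_bind]
  refine Multiset.bind_congr fun i _ => ?_
  simp only [Function.comp_apply, ← Fin.univ_val_map, Multiset.map_map]

theorem List.prod_ofFn_finSigmaFinEquiv_of_commute {M : Type*} [Monoid M] {m : ℕ} {k : Fin m → ℕ}
    (q : (i : Fin m) × Fin (k i) → M) (h : ∀ a b, a ≠ b → Commute (q a) (q b)) :
    (List.ofFn fun j => q (finSigmaFinEquiv.symm j)).prod =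
      (List.ofFn fun i => (List.ofFn fun l => q ⟨i, l⟩).prod).prod := by
  rw [List.Perm.prod_eq' (List.ofFn_finSigmaFinEquiv_perm q) (List.pairwise_ofFn.2 fun i j hij =>
    h _ _ (finSigmaFinEquiv.symm.injective.ne hij.ne)), List.prod_flatten, List.map_ofFn]
  rfl

/-! ### Functors between C*-categories -/

namespace CStarCategory

variable {A : Type*} [Category A] [CStarCategory A] {B : Type*} [Category B] [CStarCategory B]

theorem dagger_id (X : A) : dagger (𝟙 X) = 𝟙 X := by
  have h := dagger_comp (dagger (𝟙 X)) (𝟙 X)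
  rwa [Category.comp_id, dagger_dagger, Category.comp_id, eq_comm] at h

theorem IsStarFunctor.isUnitary_of_map {F : A ⥤ B} [F.Faithful] (hF : IsStarFunctor F) {X Y : A}
    {f : X ⟶ Y} (h : IsUnitary (F.map f)) : IsUnitary f := by
  constructor
  · apply F.map_injective
    rw [F.map_comp, hF.map_dagger, h.1, F.map_id]
  · apply F.map_injective
    rw [F.map_comp, hF.map_dagger, h.2, F.map_id]

theorem IsUnitary.dagger {X Y : A} {f : X ⟶ Y} (h : IsUnitary f) :
    IsUnitary (CStarCategory.dagger f) := by
  constructor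
  · rw [dagger_dagger, h.2]
  · rw [dagger_dagger, h.1]

/-- A fully faithful *-functor which is essentially surjective up to unitaries is a unitary
equivalence. -/
theorem IsStarFunctor.isUnitaryEquivalence {F : A ⥤ B} [F.Full] [F.Faithful]
    (hF : IsStarFunctor F) (h : ∀ Y, ∃ X, ∃ f : F.obj X ⟶ Y, IsUnitary f) :
    IsUnitaryEquivalence F := by
  choose X u hu using h
  have hu₁ : ∀ {Y Z : B} (f : F.obj (X Y) ⟶ Z), u Y ≫ dagger (u Y) ≫ f = f := fun f => by
    rw [← Category.assoc, (hu _).1, Category.id_comp]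
  have hu₂ : ∀ {Y Z : B} (f : Y ⟶ Z), dagger (u Y) ≫ u Y ≫ f = f := fun f => by
    rw [← Category.assoc, (hu _).2, Category.id_comp]
  -- Conjugation by the chosen unitaries; that their inverses are adjoints makes G a *-functor.
  let G : B ⥤ A :=
    { obj := X
      map := fun {Y Z} f => F.preimage (u Y ≫ f ≫ dagger (u Z))
      map_id := fun Y => F.map_injective (by simp [(hu Y).1])
      map_comp := fun f g => F.map_injective (by simp [hu₂]) }
  have hG : ∀ {Y Z : B} (f : Y ⟶ Z), F.map (G.map f) = u Y ≫ f ≫ dagger (u Z) :=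
    fun f => F.map_preimage _
  let η : ∀ Y : A, Y ≅ X (F.obj Y) := fun Y =>
    { hom := F.preimage (dagger (u (F.obj Y)))
      inv := F.preimage (u (F.obj Y))
      hom_inv_id := F.map_injective (by simp [(hu _).2])
      inv_hom_id := F.map_injective (by simp [(hu _).1]) }
  refine ⟨hF, G, ⟨fun f g => F.map_injective ?_, fun c f => F.map_injective ?_,
    fun f => F.map_injective ?_⟩, ⟨NatIso.ofComponents η fun f => F.map_injective ?_, fun Y =>
      hF.isUnitary_of_map ?_⟩, ⟨NatIso.ofComponents (fun Y => ⟨u Y, dagger (u Y), (hu Y).1,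
        (hu Y).2⟩) fun {Y Z} f => ?_, hu⟩⟩
  · rw [hF.map_add, hG, hG, hG, add_comp, comp_add]
  · rw [hF.map_smul, hG, hG, smul_comp, comp_smul]
  · rw [hF.map_dagger, hG, hG, dagger_comp, dagger_comp, dagger_dagger, Category.assoc]
  · simp [η, hG, hu₂]
  · simpa [η] using (hu (F.obj Y)).dagger
  · simp [hG, (hu Z).2]

theorem IsMultiStarFunctor.pi_comp {n : ℕ} {X Y : Fin n → Type*} [∀ i, Category (X i)]
    [∀ i, CStarCategory (X i)] [∀ i, Category (Y i)] [∀ i, CStarCategory (Y i)]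
    {F : ∀ i, X i ⥤ Y i} (hF : ∀ i, IsStarFunctor (F i)) {G : (∀ i, Y i) ⥤ B}
    (hG : IsMultiStarFunctor G) : IsMultiStarFunctor (Functor.pi F ⋙ G) where
  multilinear x y := by
    obtain ⟨L, hL⟩ := hG.multilinear (fun i => (F i).obj (x i)) (fun i => (F i).obj (y i))
    exact ⟨L.compLinearMap fun i =>
      { toFun := fun f => (F i).map f
        map_add' := (hF i).map_add
        map_smul' := (hF i).map_smul }, fun f => hL _⟩
  map_dagger x y f := by
    refine Eq.trans ?_ (hG.map_dagger (fun i => (F i).obj (x i)) (fun i => (F i).obj (y i))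
      fun i => (F i).map (f i))
    exact congrArg (G.map (X := fun i => (F i).obj (y i)) (Y := fun i => (F i).obj (x i)))
      (funext fun i => (hF i).map_dagger (f i))

end CStarCategory

/-! ### Multilinearity of iterated tensor products -/

namespace StrictMonoidalCStar

open CStarCategory

variable (A : Type u) [Category.{v} A] [CStarCategory A] [StrictMonoidalCStar A]

theorem tensorPow_obj_unit : ∀ n : ℕ, (tensorPow A n).obj (fun _ => unit) = unit
  | 0 => rfl
  | n + 1 => by
    change tensor.obj (unit, (tensorPow A n).obj fun _ => unit) = unit
    rw [tensorPow_obj_unit n]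
    exact Functor.congr_obj unit_tensor unit

theorem isMultiStarFunctor_tensorPow : ∀ n : ℕ,
    IsMultiStarFunctor (X := fun _ : Fin n => A) (tensorPow A n)
  | 0 =>
    { multilinear := fun x y =>
        ⟨{ toFun := fun f => (tensorPow A 0).map (X := x) (Y := y) f
           map_update_add' := fun _ i => i.elim0
           map_update_smul' := fun _ i => i.elim0 }, fun _ => rfl⟩
      map_dagger := fun _ _ _ => (dagger_id unit).symm }
  | n + 1 =>
    { multilinear := fun x y => by
        obtain ⟨L, hL⟩ := (isMultiStarFunctor_tensorPow n).multilinear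
          (fun i => x i.succ) (fun i => y i.succ)
        have hsucc : ∀ (f : ∀ i, x i ⟶ y i) (i : Fin n) (g : x i.succ ⟶ y i.succ),
            (fun j : Fin n => Function.update f i.succ g j.succ) =
              Function.update (fun j : Fin n => f j.succ) i g := by
          intro f i g
          funext j
          by_cases hj : j = i
          · subst hj; simp
          · rw [Function.update_of_ne hj,
              Function.update_of_ne fun e => hj (Fin.succ_injective n e)]
        let t : (x 0 ⟶ y 0) → ((tensorPow A n).obj (fun i => x i.succ) ⟶
            (tensorPow A n).obj (fun i => y i.succ)) →
            ((tensorPow A (n + 1)).obj x ⟶ (tensorPow A (n + 1)).obj y) := fun f g =>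
          tensor.map (X := (x 0, (tensorPow A n).obj fun i => x i.succ))
            (Y := (y 0, (tensorPow A n).obj fun i => y i.succ)) (f, g)
        have ht₁ : ∀ a b g, t (a + b) g = t a g + t b g := fun a b g => add_tensor a b g
        have ht₂ : ∀ a g h, t a (g + h) = t a g + t a h := fun a g h => tensor_add a g h
        have ht₃ : ∀ (c : ℂ) a g, t (c • a) g = c • t a g := fun c a g => smul_tensor c a g
        have ht₄ : ∀ (c : ℂ) a g, t a (c • g) = c • t a g := fun c a g => tensor_smul c a g
        have hzero : ∀ (f : ∀ i, x i ⟶ y i) (i : Fin n) (g : x i.succ ⟶ y i.succ),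
            Function.update f i.succ g 0 = f 0 := fun f i g =>
          Function.update_of_ne (Fin.succ_ne_zero i).symm _ _
        refine ⟨
          { toFun := fun f => t (f 0) (L fun i => f i.succ)
            map_update_add' := ?_
            map_update_smul' := ?_ }, fun f => ?_⟩
        · intro inst f i a b
          -- `MultilinearMap` quantifies over all decidability instances; this fixes the canonical
          -- one.
          obtain rfl : inst = instDecidableEqFin _ := Subsingleton.elim _ _
          induction i using Fin.cases with
          | zero => simp [ht₁]
          | succ i =>
            rw [hsucc, hsucc, hsucc, hzero, hzero, hzero, L.map_update_add, ht₂]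
        · intro inst f i c a
          obtain rfl : inst = instDecidableEqFin _ := Subsingleton.elim _ _
          induction i using Fin.cases with
          | zero => simp [ht₃]
          | succ i =>
            rw [hsucc, hsucc, hzero, hzero, L.map_update_smul, ht₄]
        · change t (f 0) (L fun i => f i.succ) = t (f 0) _
          rw [hL]
          rfl
      map_dagger := fun x y f => by
        have h := (isMultiStarFunctor_tensorPow n).map_dagger (fun i => x i.succ)
          (fun i => y i.succ) (fun i => f i.succ)
        refine Eq.trans ?_ (dagger_tensor (f 0) ((tensorPow A n).map
          (X := fun i => x i.succ) (Y := fun i => y i.succ) fun i => f i.succ))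
        rw [← h]
        rfl }

end StrictMonoidalCStar

namespace AQFT

open CStarCategory StrictMonoidalCStar

variable {C : Type u} [Category.{v} C] {O : Orthogonality C} {𝔄 : AQFT.{u, v, w} O}
  {Astar : 𝔄.UniversalAlgebra}
  {H₀ : Type w} [NormedAddCommGroup H₀] [InnerProductSpace ℂ H₀] [CompleteSpace H₀]
  {π₀ : Astar.cocone.pt →⋆ₐ[ℂ] BddOp H₀}

namespace LocalizedEndo

/-! ### The inclusion functors -/

theorem isStarFunctor_incl {U V : C} (f : U ⟶ V) : IsStarFunctor (incl π₀ f) where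
  map_add _ _ := rfl
  map_smul _ _ := rfl
  map_dagger _ := rfl

theorem faithful_incl {U V : C} (f : U ⟶ V) : (incl π₀ f).Faithful where
  map_injective {_ _ S T} h := hom_ext
    (show op ((incl π₀ f).map S) = op ((incl π₀ f).map T) by rw [h])

/-- An intertwiner of endomorphisms localized in U commutes with every algebra orthogonal to U, so
Haag duality moves it from 𝔐(V) down to 𝔐(U). -/
theorem full_incl (hHaag : HaagDuality π₀) {U V : C} (f : U ⟶ V) : (incl π₀ f).Full where
  map_surjective {ρ σ} T := ⟨homMk (op T) (mem_bicommutant_of_intertwines hHaag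
    (ρ := ρ) (σ := σ) fun _ _ => intertwines T _) fun b => intertwines T b, rfl⟩

/-- Every endomorphism localized in `V` is unitarily equivalent to one localized in `U`, for a
morphism `U ⟶ V`. -/
theorem exists_isUnitary_incl (hHaag : HaagDuality π₀) {U V : C} (f : U ⟶ V)
    (ρ : LocalizedEndo π₀ V) :
    ∃ σ : LocalizedEndo π₀ U, ∃ T : (incl π₀ f).obj σ ⟶ ρ, IsUnitary T := by
  obtain ⟨v, hv⟩ := ρ.exists_transports U
  have hm := hv.mem_bicommutant hHaag (𝟙 V) f
  have hvv := Unitary.mul_star_self_of_mem hv.1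
  have hs := Unitary.star_mul_self_of_mem hv.1
  let x : unitary (quasiLocal π₀) := ⟨⟨v, bicommutant_le_quasiLocal π₀ _ hm⟩,
    Subtype.ext hs, Subtype.ext hvv⟩
  -- σ = Ad(v) ∘ ρ is localized in U since `v` transports ρ there; v* is a morphism over V because U
  -- ⟶ V puts `v` in 𝔐(V).
  let σ : LocalizedEndo π₀ U :=
    { endo := (Unitary.conjStarAlgAut ℂ (quasiLocal π₀) x :
        quasiLocal π₀ →⋆ₐ[ℂ] quasiLocal π₀).comp ρ.endo
      transportable := fun W => by
        obtain ⟨u, hu⟩ := ρ.exists_transports W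
        refine ⟨u * star v, mul_mem hu.1 (Unitary.star_mem hv.1), fun {W' Z} f' g h b => ?_⟩
        change u * star v * (v * (ρ.endo (inclQuasiLocal π₀ W' b) : BddOp H₀) * star v) = _
        calc _ = u * (star v * v) * (ρ.endo (inclQuasiLocal π₀ W' b) : BddOp H₀) * star v := by
              simp only [mul_assoc]
          _ = _ := by
              rw [hs, mul_one, hu.2 f' g h _ b.2, mul_assoc]
              rfl
      localized := fun {U' Z} f' g h => StarAlgHom.ext fun b => Subtype.ext <| by
        change v * (ρ.endo (inclQuasiLocal π₀ U' b) : BddOp H₀) * star v = b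
        rw [hv.2 f' g h _ b.2, mul_assoc, hvv, mul_one]
        rfl }
  refine ⟨σ, homMk (star v) (star_mem hm) fun b => ?_, hom_ext ?_, hom_ext ?_⟩
  · change star v * (v * (ρ.endo b : BddOp H₀) * star v) = _
    rw [← mul_assoc, ← mul_assoc, hs, one_mul]
  · change star (star v) * star v = 1
    rw [star_star, hvv]
  · change star v * star (star v) = 1
    rw [star_star, hs]

theorem isUnitaryEquivalence_incl (hHaag : HaagDuality π₀) {U V : C} (f : U ⟶ V) :
    IsUnitaryEquivalence (incl π₀ f) :=
  have := faithful_incl (π₀ := π₀) f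
  have := full_incl hHaag f
  (isStarFunctor_incl f).isUnitaryEquivalence (exists_isUnitary_incl hHaag f)

/-- The functor `(ρ₁, …, ρₙ) ↦ ρ₁ ∘ ⋯ ∘ ρₙ`. -/
@[reducible]
def compPow [IsFiltered C] (hHaag : HaagDuality π₀) (V : C) (n : ℕ) :
    (Fin n → LocalizedEndo π₀ V) ⥤ LocalizedEndo π₀ V :=
  letI := monoidalStructure hHaag V
  tensorPow (LocalizedEndo π₀ V) n

theorem pair_compPow_map [IsFiltered C] (hHaag : HaagDuality π₀) (V : C) :
    ∀ {n : ℕ} {x y : Fin n → LocalizedEndo π₀ V} (T : ∀ i, x i ⟶ y i),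
      pair ((compPow hHaag V n).map (X := x) (Y := y) T) =
        (List.ofFn fun i => pair (T i)).prod
  | 0, _, _, _ => by
    rw [List.ofFn_zero, List.prod_nil]
    rfl
  | n + 1, x, y, T => by
    rw [List.ofFn_succ, List.prod_cons, ← pair_compPow_map hHaag V fun i => T i.succ]
    rfl

end LocalizedEndo

/-! ### The prefactorization algebra -/

/-- The functor assigned to an operation of the prefactorization operad. -/
def sectorActFunctor [IsFiltered C] (hHaag : HaagDuality π₀) {n : ℕ} {U : Fin n → C} {V : C}
    (f : PrefactOp O U V) :
    (∀ i, sectorCat π₀ (LocalizedEndo.monoidalStructure hHaag) (U i)) ⥤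
      sectorCat π₀ (LocalizedEndo.monoidalStructure hHaag) V :=
  (Functor.pi fun i => LocalizedEndo.incl π₀ (f.hom i)) ⋙
    LocalizedEndo.compPow hHaag V n

/-- Inclusions do not change pairs, so a factorization product is an ordered product in
`TwistedPair`, in which V no longer appears. -/
theorem pair_sectorActFunctor_map [IsFiltered C] (hHaag : HaagDuality π₀) {n : ℕ} {U : Fin n → C}
    {V : C} (f : PrefactOp O U V) {x y : ∀ i, LocalizedEndo π₀ (U i)} (T : ∀ i, x i ⟶ y i) :
    LocalizedEndo.pair ((sectorActFunctor hHaag f).map (X := x) (Y := y) T) =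
      (List.ofFn fun i => LocalizedEndo.pair (T i)).prod :=
  LocalizedEndo.pair_compPow_map hHaag V fun i => (LocalizedEndo.incl π₀ (f.hom i)).map (T i)

/-- The strictly monoidal multilinear *-functor assigned to an operation of the prefactorization
operad. -/
def sectorAct [IsFiltered C] (hHaag : HaagDuality π₀) (hO : O.HasOrthogonalEnlargements) {n : ℕ}
    {U : Fin n → C} {V : C} (f : PrefactOp O U V) :
    StrictMonoidalMultiFunctor
      (fun i => sectorCat π₀ (LocalizedEndo.monoidalStructure hHaag) (U i))
      (sectorCat π₀ (LocalizedEndo.monoidalStructure hHaag) V) where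
  functor := sectorActFunctor hHaag f
  isMultiStarFunctor := IsMultiStarFunctor.pi_comp
    (fun i => LocalizedEndo.isStarFunctor_incl (f.hom i))
    (letI := LocalizedEndo.monoidalStructure hHaag V
    isMultiStarFunctor_tensorPow (LocalizedEndo π₀ V) n)
  map_unit :=
    letI := LocalizedEndo.monoidalStructure hHaag V
    tensorPow_obj_unit (LocalizedEndo π₀ V) n
  map_tensor := LocalizedEndo.functor_ext fun {x y} T => by
    refine (pair_sectorActFunctor_map hHaag f
      fun i => LocalizedEndo.tensorHom hHaag (T.1 i) (T.2 i)).trans ?_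
    refine (List.prod_ofFn_mul_of_commute _ _ fun i j hij =>
      LocalizedEndo.pair_commute_of_perp hHaag hO (f.perp i j hij) (T.1 i) (T.2 j)).trans ?_
    rw [← pair_sectorActFunctor_map hHaag f, ← pair_sectorActFunctor_map hHaag f]
    rfl

/-- The prefactorization algebra of superselection sectors. -/
def sectorPrefactorization [IsFiltered C] (hHaag : HaagDuality π₀)
    (hO : O.HasOrthogonalEnlargements) :
    PrefactorizationStructure O (sectorCat π₀ (LocalizedEndo.monoidalStructure hHaag)) where
  act f := sectorAct hHaag hO f
  act_id V := LocalizedEndo.functor_ext fun {x y} T => by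
    refine (pair_sectorActFunctor_map hHaag (PrefactOp.single O (𝟙 V)) T).trans ?_
    rw [List.ofFn_succ, List.ofFn_zero, List.prod_singleton]
    rfl
  act_comp {m k W U V} f g := LocalizedEndo.functor_ext fun {x y} T => by
    refine (pair_sectorActFunctor_map hHaag (f.comp g) fun j =>
      T (finSigmaFinEquiv.symm j).1 (finSigmaFinEquiv.symm j).2).trans ?_
    -- All inner inputs, across and within blocks, are pairwise orthogonal after mapping to V, so
    -- the product may be grouped by blocks.
    refine (List.prod_ofFn_finSigmaFinEquiv_of_commute
      (fun a : (i : Fin m) × Fin (k i) => LocalizedEndo.pair (T a.1 a.2)) fun a b hab =>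
        LocalizedEndo.pair_commute_of_perp hHaag hO (PrefactOp.perp_comp f g a b hab) _ _).trans ?_
    refine Eq.trans ?_ (pair_sectorActFunctor_map hHaag f fun i =>
      (sectorActFunctor hHaag (g i)).map (T i)).symm
    refine congrArg (fun q => (List.ofFn q).prod) (funext fun i => ?_)
    exact (pair_sectorActFunctor_map hHaag (g i) (T i)).symm
  act_permute f σ := LocalizedEndo.functor_ext fun {x y} T => by
    refine (pair_sectorActFunctor_map hHaag (f.permute σ) fun i => T (σ i)).trans ?_
    refine (List.prod_ofFn_comp_perm_of_commute (fun i => LocalizedEndo.pair (T i)) σ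
      fun i j hij => LocalizedEndo.pair_commute_of_perp hHaag hO (f.perp i j hij) _ _).trans ?_
    exact (pair_sectorActFunctor_map hHaag f T).symm

theorem sectorPrefactorization_unary [IsFiltered C] (hHaag : HaagDuality π₀)
    (hO : O.HasOrthogonalEnlargements) {U V : C} (f : U ⟶ V) :
    (sectorPrefactorization hHaag hO).unary f = LocalizedEndo.incl π₀ f :=
  LocalizedEndo.functor_ext fun {x y} T => by
    refine (pair_sectorActFunctor_map hHaag (PrefactOp.single O f) fun _ => T).trans ?_
    rw [List.ofFn_succ, List.ofFn_zero, List.prod_singleton]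
    rfl

theorem isLocallyConstant_sectorPrefactorization [IsFiltered C] (hHaag : HaagDuality π₀)
    (hO : O.HasOrthogonalEnlargements) :
    (sectorPrefactorization hHaag hO).IsLocallyConstant := fun f => by
  rw [sectorPrefactorization_unary]
  exact
    { map_unit := rfl
      map_tensor := rfl
      isUnitaryEquivalence := LocalizedEndo.isUnitaryEquivalence_incl hHaag f }

end AQFT

end

theorem theorem3p10 {C : Type u} [Category.{v} C] [IsFiltered C] (O : Orthogonality C)
    (hO₁ : O.HasComplements) (hO₂ : O.HasOrthogonalEnlargements)
    (𝔄 : AQFT.{u, v, w} O) (Astar : 𝔄.UniversalAlgebra)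
    (H₀ : Type w) [NormedAddCommGroup H₀] [InnerProductSpace ℂ H₀] [CompleteSpace H₀]
    (π₀ : Astar.cocone.pt →⋆ₐ[ℂ] BddOp H₀)
    (hfaithful : AQFT.IsLocallyFaithful π₀) (hHaag : AQFT.HaagDuality π₀) :
    (∀ U : C, ∃ Φ : AQFT.LocalizedEndo π₀ U ⥤ AQFT.LocalizedSector π₀ U, AQFT.IsComparison Φ) ∧
    ∃ m : ∀ U : C, StrictMonoidalCStar (AQFT.LocalizedEndo π₀ U),
      (∀ U : C, AQFT.IsCompositionProduct (m U)) ∧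
      ∃ F : PrefactorizationStructure O (AQFT.sectorCat π₀ m),
        (∀ {n : ℕ} {U : Fin n → C} {V : C} (f : PrefactOp O U V),
          (F.act f).functor =
            (Functor.pi fun i => AQFT.LocalizedEndo.incl π₀ (f.hom i)) ⋙
              StrictMonoidalCStar.tensorPow (AQFT.sectorCat π₀ m V) n) ∧
        F.IsLocallyConstant := by
  exact ⟨fun U => ⟨_, AQFT.isComparison_comparison hO₁ hHaag U⟩,
    AQFT.LocalizedEndo.monoidalStructure hHaag,
    AQFT.LocalizedEndo.isCompositionProduct_monoidalStructure hHaag,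
    AQFT.sectorPrefactorization hHaag hO₂, fun _ => rfl,
    AQFT.isLocallyConstant_sectorPrefactorization hHaag hO₂⟩
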